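/- Let the metatheory be the internal language of a category $\mathcal E$ that is regular and locally cartesian closed, with disjoint and stable finite coproducts (finitary extensive) and a natural number object $N$; let $\mathbb Q$ be the object of rational numbers of $\mathcal E$ with its strict order. A monomorphism $X\to Y$ of $\mathcal E$ is $\neg\neg$-stable if there is a map $\neg\neg X\to X$ over $Y$. A classifier for $\neg\neg$-stable propositions is a $\neg\neg$-stable map $m:1\to\Omega$ such that every $\neg\neg$-stable monomorphism is a pullback of $m$ along a unique map to $\Omega$. Let $\square$ be a category of cubes internal to $\mathcal E$, i.e. an internal Lawvere theory: its objects are the $[n]$, $n\in N$, $[0]$ is terminal, $[n+1]=[n]\times[1]$, and there are two given maps $0,1:[0]\to[1]$ (the endpoints, not assumed distinct). Cubical sets are the internal presheaves on $\square$; $\Delta:\mathcal E\to\widehat\square$ is the constant presheaf functor and $\mathbb I$ is the presheaf represented by $[1]$. Homotopies are maps out of $\mathbb I\times A$, and $f:X\to Y$ is an h-proposition if any two points of $X$ in the same fibre are joined by a path in the fibre, i.e. if $\mathrm{Path}_Y(X)\to X\times_YX$ has a section. Let a class of maps of cubical sets, called Kan fibrations, be given, such that: fibrations are stable under pullback; they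 are closed under composition; the dependent product of a fibration along a fibration exists and is a fibration; every map between constant cubical sets is a fibration; for every point $d$ of $\mathbb I$ and every cubical set $A$ the map $(d,\mathrm{id}):A\to\mathbb I\times A$ has the left lifting property against fibrations (also for families of $d$ and $A$ indexed by any object of $\mathcal E$); and every fibration $X\to Y$ has a propositional truncation $\|X\|_Y\to Y$ (a fibration and h-proposition over $Y$, universal among those that receive a map from $X$ over $Y$) which is preserved by pullback. Types in context $Y$ are fibrations over $Y$, and terms are their sections. A cocut in context $Y$ is a fibration and h-proposition $C\to Y\times\Delta\mathbb Q$ for which the following types in context $Y$ have terms: - (boundedness) $\bigl\|\sum_{a,b:\mathbb Q}\neg C(a)\times C(b)\bigr\|$; - (closedness) $\prod_{a:\mathbb Q}\bigl(\prod_{b:\mathbb Q}(a<b\to C(b))\bigr)\to C(a)$; - (locatedness) $\prod_{a,b:\mathbb Q}\, a<b\to\|\neg C(a)+C(b)\|$. Suppose that $\mathcal E$ has a classifier for $\neg\neg$-stable propositions. Then there is a type of all Dedekind real numbers in cubical sets: there are a fibrant cubical set $R$ and a cocut $C\to R\times\Delta\mathbb Q$ in context $R$ such that, for every cubical set $Y$,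 1. every cocut $D\to Y\times\Delta\mathbb Q$ in context $Y$ is homotopy equivalent over $Y\times\Delta\mathbb Q$ to the pullback of $C$ along $\chi\times\mathrm{id}$ for some map $\chi:Y\to R$; 2. if the pullbacks of $C$ along $\chi\times\mathrm{id}$ and $\chi'\times\mathrm{id}$, for maps $\chi,\chi':Y\to R$, are homotopy equivalent over $Y\times\Delta\mathbb Q$, then $\chi$ and $\chi'$ are homotopic. -/

import Mathlib

open CategoryTheory CategoryTheory.Limits

universe v u

namespace CubicalReals

noncomputable section

section General

variable {C : Type u} [Category.{v} C]

/-- `C` is locally cartesian closed: every pullback functor between slices has a right adjoint. -/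
def LocallyCartesianClosed (C : Type u) [Category.{v} C] [HasPullbacks C] : Prop :=
  ∀ ⦃X Y : C⦄ (f : X ⟶ Y), (Over.pullback f).IsLeftAdjoint

/-- `p : P ⟶ Z` is the dependent product of `f : X ⟶ Y` along `g : Y ⟶ Z`: maps `w ⟶ p` over `Z`
correspond naturally to maps `g^* w ⟶ f` over `Y`. -/
def IsDepProd [HasPullbacks C] {X Y Z P : C} (f : X ⟶ Y) (g : Y ⟶ Z) (p : P ⟶ Z) : Prop :=
  Nonempty (((Over.pullback g).op ⋙ yoneda.obj (Over.mk f)).RepresentableBy (Over.mk p))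

/-- `n` is the negation of `f : X ⟶ Y` in the slice over `Y`: the object of functions from `X` to
the empty family, i.e. the dependent product along `f` of the empty family over `X`. -/
def IsNegation [HasPullbacks C] {X Y M : C} (f : X ⟶ Y) (n : M ⟶ Y) : Prop :=
  ∃ (O : C) (hO : IsInitial O), IsDepProd (hO.to X) f n

/-- `f : X ⟶ Y` is stable under double negation: there is a map `¬¬X ⟶ X` over `Y`. -/
def IsNotNotStable [HasPullbacks C] {X Y : C} (f : X ⟶ Y) : Prop :=
  ∃ (M M' : C) (n : M ⟶ Y) (n' : M' ⟶ Y), IsNegation f n ∧ IsNegation n n' ∧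
    ∃ k : M' ⟶ X, k ≫ f = n'

/-- `m : 1 ⟶ Ω` is a classifier for `¬¬`-stable propositions: it is a `¬¬`-stable proposition, and
every `¬¬`-stable proposition (monomorphism) is a pullback of it along a unique map. -/
structure IsNotNotStableClassifier [HasFiniteLimits C] {Ω : C} (m : ⊤_ C ⟶ Ω) : Prop where
  stable : IsNotNotStable m
  classify : ∀ ⦃X Y : C⦄ (f : X ⟶ Y), Mono f → IsNotNotStable f →
    ∃! χ : Y ⟶ Ω, IsPullback (terminal.from X) f m χ

/-- A natural number object (with parameters, which is automatic in a cartesian closed category). -/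
structure NNO (C : Type u) [Category.{v} C] [HasFiniteLimits C] where
  N : C
  zero : ⊤_ C ⟶ N
  succ : N ⟶ N
  exists_unique_rec : ∀ ⦃A X : C⦄ (a : A ⟶ X) (s : X ⟶ X), ∃! r : A ⨯ N ⟶ X,
    prod.lift (𝟙 A) (terminal.from A ≫ zero) ≫ r = a ∧ prod.map (𝟙 A) succ ≫ r = r ≫ s

end General

section Numbers

variable {E : Type u} [Category.{v} E] [HasFiniteLimits E]

namespace NNO

variable (N : NNO E)

/-- The function defined by parametrised recursion. -/
def rec' {A X : E} (a : A ⟶ X) (s : X ⟶ X) : A ⨯ N.N ⟶ X :=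
  (N.exists_unique_rec a s).choose

/-- `m + 0 = m`, `m + (n + 1) = (m + n) + 1`. -/
def plusHom : N.N ⨯ N.N ⟶ N.N := N.rec' (𝟙 N.N) N.succ

/-- `m * 0 = 0`, `m * (n + 1) = m * n + m`, by recursion on the pair `(m, m * n)`. -/
def timesHom : N.N ⨯ N.N ⟶ N.N :=
  N.rec' (prod.lift (𝟙 N.N) (terminal.from N.N ≫ N.zero))
    (prod.lift prod.fst (prod.lift prod.snd prod.fst ≫ N.plusHom)) ≫ prod.snd

variable {N} {T : E}

/-- Sum of two generalised elements of `N`. -/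
def plus (a b : T ⟶ N.N) : T ⟶ N.N := prod.lift a b ≫ N.plusHom

/-- Product of two generalised elements of `N`. -/
def times (a b : T ⟶ N.N) : T ⟶ N.N := prod.lift a b ≫ N.timesHom

end NNO

open NNO in
/-- The object `Q` of rational numbers with its strict order `Lt ↪ Q × Q`. `Q` is the quotient of
`N × N × N`, the triple `(a, b, c)` standing for `(a - b) / (c + 1)`, by the relation
`(a - b) / (c + 1) = (a' - b') / (c' + 1)`, written with natural numbers as
`a (c' + 1) + b' (c + 1) = a' (c + 1) + b (c' + 1)`. -/
structure Rationals (N : NNO E) where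
  Q : E
  frac : N.N ⨯ (N.N ⨯ N.N) ⟶ Q
  regularEpi_frac : IsRegularEpi frac
  frac_eq_iff : ∀ ⦃T : E⦄ (a b c a' b' c' : T ⟶ N.N),
    prod.lift a (prod.lift b c) ≫ frac = prod.lift a' (prod.lift b' c') ≫ frac ↔
      plus (times a (c' ≫ N.succ)) (times b' (c ≫ N.succ)) =
        plus (times a' (c ≫ N.succ)) (times b (c' ≫ N.succ))
  Lt : E
  /-- the smaller element -/
  ltFst : Lt ⟶ Q
  /-- the larger element -/
  ltSnd : Lt ⟶ Q
  mono_lt : Mono (prod.lift ltFst ltSnd)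
  lt_iff : ∀ ⦃T : E⦄ (a b c a' b' c' : T ⟶ N.N),
    (∃ l : T ⟶ Lt, l ≫ ltFst = prod.lift a (prod.lift b c) ≫ frac ∧
        l ≫ ltSnd = prod.lift a' (prod.lift b' c') ≫ frac) ↔
      ∃ k : T ⟶ N.N,
        plus (plus (times a (c' ≫ N.succ)) (times b' (c ≫ N.succ))) (k ≫ N.succ) =
          plus (times a' (c ≫ N.succ)) (times b (c' ≫ N.succ))

/-- A category of cubes, internal to the metatheory `E`: an internal category whose objects are
the natural numbers (`n` is written `[n]`), such that `[0]` is terminal and `[n + 1]` is the product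
of `[n]` and the interval `[1]`; so it has finite products and `[n]` is the `n`-fold power of `[1]`.
The interval comes with two global sections, the endpoints of paths (not assumed distinct).
Composition is given on generalised elements `T ⟶ Hom`, naturally in `T`; it is written in
diagrammatic order. -/
structure CubeCategory (N : NNO E) where
  Hom : E
  dom : Hom ⟶ N.N
  cod : Hom ⟶ N.N
  id : N.N ⟶ Hom
  id_dom : id ≫ dom = 𝟙 N.N
  id_cod : id ≫ cod = 𝟙 N.N
  comp : ∀ {T : E} (f g : T ⟶ Hom), f ≫ cod = g ≫ dom → (T ⟶ Hom)
  comp_dom : ∀ {T : E} (f g : T ⟶ Hom) (h : f ≫ cod = g ≫ dom), comp f g h ≫ dom = f ≫ dom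
  comp_cod : ∀ {T : E} (f g : T ⟶ Hom) (h : f ≫ cod = g ≫ dom), comp f g h ≫ cod = g ≫ cod
  comp_natural : ∀ {S T : E} (t : S ⟶ T) (f g : T ⟶ Hom) (h : f ≫ cod = g ≫ dom),
    t ≫ comp f g h = comp (t ≫ f) (t ≫ g) (by simp only [Category.assoc, h])
  id_comp : ∀ {T : E} (f : T ⟶ Hom),
    comp (f ≫ dom ≫ id) f (by simp only [Category.assoc, id_cod, Category.comp_id]) = f
  comp_id : ∀ {T : E} (f : T ⟶ Hom),
    comp f (f ≫ cod ≫ id) (by simp only [Category.assoc, id_dom, Category.comp_id]) = f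
  assoc : ∀ {T : E} (f g k : T ⟶ Hom) (h : f ≫ cod = g ≫ dom) (h' : g ≫ cod = k ≫ dom),
    comp (comp f g h) k (by rw [comp_cod, h']) = comp f (comp g k h') (by rw [comp_dom, h])
  exists_unique_bang : ∀ {T : E} (n : T ⟶ N.N),
    ∃! f : T ⟶ Hom, f ≫ dom = n ∧ f ≫ cod = terminal.from T ≫ N.zero
  /-- the projections `[n + 1] ⟶ [n]` -/
  fst : N.N ⟶ Hom
  /-- the projections `[n + 1] ⟶ [1]` -/
  snd : N.N ⟶ Hom
  fst_dom : fst ≫ dom = N.succ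
  fst_cod : fst ≫ cod = 𝟙 N.N
  snd_dom : snd ≫ dom = N.succ
  snd_cod : snd ≫ cod = terminal.from N.N ≫ N.zero ≫ N.succ
  exists_unique_pair : ∀ {T : E} (f g : T ⟶ Hom), f ≫ dom = g ≫ dom →
    g ≫ cod = terminal.from T ≫ N.zero ≫ N.succ →
    ∃! p : T ⟶ Hom, ∃ hp : p ≫ cod = f ≫ cod ≫ N.succ,
      comp p (f ≫ cod ≫ fst) (by simp only [Category.assoc, fst_dom, hp]) = f ∧
      comp p (f ≫ cod ≫ snd) (by simp only [Category.assoc, snd_dom, hp]) = g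
  end₀ : ⊤_ E ⟶ Hom
  end₁ : ⊤_ E ⟶ Hom
  end₀_dom : end₀ ≫ dom = N.zero
  end₀_cod : end₀ ≫ cod = N.zero ≫ N.succ
  end₁_dom : end₁ ≫ dom = N.zero
  end₁_cod : end₁ ≫ cod = N.zero ≫ N.succ

end Numbers

section CubicalSets

variable {E : Type u} [Category.{v} E] [HasFiniteLimits E] {N : NNO E}

/-- A cubical set: an internal presheaf on the category of cubes. The carrier is the object of all
cubes, each with its dimension, and a generalised element `x` of dimension `[n]` is restricted along
`φ : [m] ⟶ [n]` to `res x φ` of dimension `[m]`. -/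
structure CubicalSet (B : CubeCategory N) where
  carrier : E
  dim : carrier ⟶ N.N
  res : ∀ {T : E} (x : T ⟶ carrier) (φ : T ⟶ B.Hom), x ≫ dim = φ ≫ B.cod → (T ⟶ carrier)
  res_dim : ∀ {T : E} (x : T ⟶ carrier) (φ : T ⟶ B.Hom) (h : x ≫ dim = φ ≫ B.cod),
    res x φ h ≫ dim = φ ≫ B.dom
  res_natural : ∀ {S T : E} (t : S ⟶ T) (x : T ⟶ carrier) (φ : T ⟶ B.Hom)
    (h : x ≫ dim = φ ≫ B.cod),
    t ≫ res x φ h = res (t ≫ x) (t ≫ φ) (by simp only [Category.assoc, h])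
  res_id : ∀ {T : E} (x : T ⟶ carrier),
    res x (x ≫ dim ≫ B.id) (by simp only [Category.assoc, B.id_cod, Category.comp_id]) = x
  res_comp : ∀ {T : E} (x : T ⟶ carrier) (ψ φ : T ⟶ B.Hom) (h : x ≫ dim = φ ≫ B.cod)
    (h' : ψ ≫ B.cod = φ ≫ B.dom),
    res x (B.comp ψ φ h') (by rw [B.comp_cod, h]) = res (res x φ h) ψ (by rw [res_dim, h'])

namespace CubicalSet

variable {B : CubeCategory N}

/-- A map of cubical sets: a dimension preserving map which commutes with restriction. -/
@[ext]
structure Hom (X Y : CubicalSet B) where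
  map : X.carrier ⟶ Y.carrier
  map_dim : map ≫ Y.dim = X.dim
  map_res : ∀ {T : E} (x : T ⟶ X.carrier) (φ : T ⟶ B.Hom) (h : x ≫ X.dim = φ ≫ B.cod),
    X.res x φ h ≫ map = Y.res (x ≫ map) φ (by rw [Category.assoc, map_dim, h])

instance : Category (CubicalSet B) where
  Hom := Hom
  id X := ⟨𝟙 _, by simp, by intros; simp⟩
  comp f g := ⟨f.map ≫ g.map, by rw [Category.assoc, g.map_dim, f.map_dim], by
    intro T x φ h
    rw [← Category.assoc, f.map_res, g.map_res]
    simp only [Category.assoc]⟩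
  id_comp f := Hom.ext (Category.id_comp _)
  comp_id f := Hom.ext (Category.comp_id _)
  assoc f g h := Hom.ext (Category.assoc _ _ _)

@[ext]
theorem hom_ext {X Y : CubicalSet B} {f g : X ⟶ Y} (h : f.map = g.map) : f = g := Hom.ext h

@[simp]
theorem comp_map {X Y Z : CubicalSet B} (f : X ⟶ Y) (g : Y ⟶ Z) :
    (f ≫ g).map = f.map ≫ g.map := rfl

theorem res_congr (X : CubicalSet B) {T : E} {x y : T ⟶ X.carrier} {φ ψ : T ⟶ B.Hom}
    (hx : x = y) (hφ : φ = ψ) (h : x ≫ X.dim = φ ≫ B.cod) (h' : y ≫ X.dim = ψ ≫ B.cod) :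
    X.res x φ h = X.res y ψ h' := by
  subst hx hφ; rfl

/-- The terminal cubical set, with one cube of each dimension. -/
abbrev point (B : CubeCategory N) : CubicalSet B where
  carrier := N.N
  dim := 𝟙 _
  res x φ _ := φ ≫ B.dom
  res_dim := by intros; simp
  res_natural := by intros; simp
  res_id := by intro T x; simp [B.id_dom]
  res_comp := by intro T x ψ φ h h'; exact B.comp_dom _ _ _

instance : HasTerminal (CubicalSet B) := by
  refine IsTerminal.hasTerminal (X := point B) (IsTerminal.ofUniqueHom (fun X => ⟨X.dim, ?_, ?_⟩) ?_)
  · exact Category.comp_id _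
  · intro T x φ h; exact X.res_dim _ _ _
  · intro X f
    apply hom_ext
    have := f.map_dim
    exact (Category.comp_id _).symm.trans this

/-- Pullbacks of cubical sets are computed on carriers. -/
abbrev pullbackObj {X Y Z : CubicalSet B} (f : X ⟶ Z) (g : Y ⟶ Z) : CubicalSet B where
  carrier := pullback f.map g.map
  dim := pullback.fst _ _ ≫ X.dim
  res {T} p φ h := pullback.lift
    (X.res (p ≫ pullback.fst _ _) φ (by rw [Category.assoc, h]))
    (Y.res (p ≫ pullback.snd _ _) φ (by
      rw [Category.assoc, ← g.map_dim, ← pullback.condition_assoc, f.map_dim, h]))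
    (by
      rw [f.map_res, g.map_res]
      exact res_congr _ (by simp only [Category.assoc, pullback.condition]) rfl _ _)
  res_dim p φ h := by rw [pullback.lift_fst_assoc, X.res_dim]
  res_natural t p φ h := by
    apply pullback.hom_ext
    · simp only [Category.assoc, pullback.lift_fst, X.res_natural]
    · simp only [Category.assoc, pullback.lift_snd, Y.res_natural]
  res_id p := by
    apply pullback.hom_ext
    · rw [pullback.lift_fst]
      refine (X.res_congr rfl ?_ _ ?_).trans (X.res_id _)
      · simp only [Category.assoc]
      · simp only [Category.assoc, B.id_cod, Category.comp_id]
    · rw [pullback.lift_snd]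
      refine (Y.res_congr rfl ?_ _ ?_).trans (Y.res_id _)
      · rw [← f.map_dim, pullback.condition_assoc, g.map_dim]
        simp only [Category.assoc]
      · simp only [Category.assoc, B.id_cod, Category.comp_id]
  res_comp p ψ φ h h' := by
    apply pullback.hom_ext
    · have e : (p ≫ pullback.fst f.map g.map) ≫ X.dim = φ ≫ B.cod := by
        rw [Category.assoc, h]
      refine (pullback.lift_fst _ _ _).trans (Eq.trans ?_ (pullback.lift_fst _ _ _).symm)
      refine (X.res_comp _ ψ φ e h').trans (X.res_congr ?_ rfl _ _)
      exact (pullback.lift_fst _ _ _).symm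
    · have e : (p ≫ pullback.snd f.map g.map) ≫ Y.dim = φ ≫ B.cod := by
        rw [Category.assoc, ← g.map_dim, ← pullback.condition_assoc, f.map_dim, h]
      refine (pullback.lift_snd _ _ _).trans (Eq.trans ?_ (pullback.lift_snd _ _ _).symm)
      refine (Y.res_comp _ ψ φ e h').trans (Y.res_congr ?_ rfl _ _)
      exact (pullback.lift_snd _ _ _).symm

instance : HasPullbacks (CubicalSet B) := by
  have key : ∀ {X Y Z : CubicalSet B} (f : X ⟶ Z) (g : Y ⟶ Z), HasLimit (cospan f g) := ?_
  · exact hasPullbacks_of_hasLimit_cospan _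
  intro X Y Z f g
  let p₁ : pullbackObj f g ⟶ X := ⟨pullback.fst _ _, rfl, fun p φ h => pullback.lift_fst _ _ _⟩
  let p₂ : pullbackObj f g ⟶ Y := ⟨pullback.snd _ _, by
    change _ = pullback.fst f.map g.map ≫ X.dim
    rw [← f.map_dim, pullback.condition_assoc, g.map_dim],
    fun p φ h => pullback.lift_snd _ _ _⟩
  have w : p₁ ≫ f = p₂ ≫ g := hom_ext pullback.condition
  refine ⟨⟨⟨PullbackCone.mk p₁ p₂ w, PullbackCone.IsLimit.mk w
    (fun s => ⟨pullback.lift s.fst.map s.snd.map (congrArg Hom.map s.condition), ?_, ?_⟩)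
    ?_ ?_ ?_⟩⟩⟩
  · change _ ≫ pullback.fst f.map g.map ≫ X.dim = _
    rw [pullback.lift_fst_assoc]; exact s.fst.map_dim
  · intro T x φ h
    apply pullback.hom_ext
    · refine (Category.assoc _ _ _).trans ?_
      rw [pullback.lift_fst]
      refine (s.fst.map_res x φ h).trans ?_
      refine Eq.trans ?_ (pullback.lift_fst _ _ _).symm
      exact X.res_congr
        ((Category.assoc _ _ _).trans (congrArg (x ≫ ·) (pullback.lift_fst _ _ _))).symm rfl _ _
    · refine (Category.assoc _ _ _).trans ?_
      rw [pullback.lift_snd]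
      refine (s.snd.map_res x φ h).trans ?_
      refine Eq.trans ?_ (pullback.lift_snd _ _ _).symm
      exact Y.res_congr
        ((Category.assoc _ _ _).trans (congrArg (x ≫ ·) (pullback.lift_snd _ _ _))).symm rfl _ _
  · intro s; exact hom_ext (pullback.lift_fst _ _ _)
  · intro s; exact hom_ext (pullback.lift_snd _ _ _)
  · intro s k h₁ h₂
    apply hom_ext
    apply pullback.hom_ext
    · exact (congrArg Hom.map h₁).trans (pullback.lift_fst _ _ _).symm
    · exact (congrArg Hom.map h₂).trans (pullback.lift_snd _ _ _).symm

instance : HasFiniteLimits (CubicalSet B) := hasFiniteLimits_of_hasTerminal_and_pullbacks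

/-- The constant cubical set `Δ S`: its object of cubes of each dimension is `S`. -/
abbrev constObj (B : CubeCategory N) (S : E) : CubicalSet B where
  carrier := S ⨯ N.N
  dim := prod.snd
  res := fun x φ _ => prod.lift (x ≫ prod.fst) (φ ≫ B.dom)
  res_dim := by intros; rw [prod.lift_snd]
  res_natural := by intros; rw [prod.comp_lift, Category.assoc, Category.assoc]
  res_id := by
    intro T x
    apply Limits.prod.hom_ext
    · rw [prod.lift_fst]
    · rw [prod.lift_snd, Category.assoc, Category.assoc, B.id_dom, Category.comp_id]
  res_comp := by
    intro T x ψ φ h h'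
    rw [prod.lift_fst, B.comp_dom]

/-- The constant cubical set functor `Δ`. -/
abbrev const (B : CubeCategory N) : E ⥤ CubicalSet B where
  obj S := constObj B S
  map {S S'} f :=
    { map := prod.map f (𝟙 N.N)
      map_dim := (prod.map_snd _ _).trans (Category.comp_id _)
      map_res := by
        intro T x φ h
        change prod.lift (x ≫ prod.fst) (φ ≫ B.dom) ≫ prod.map f (𝟙 N.N) =
          prod.lift ((x ≫ prod.map f (𝟙 N.N)) ≫ prod.fst) (φ ≫ B.dom)
        simp }
  map_id S := hom_ext prod.map_id_id
  map_comp f g := hom_ext (by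
    change prod.map (f ≫ g) (𝟙 _) = prod.map f (𝟙 _) ≫ prod.map g (𝟙 _)
    simp)

/-- The interval, i.e. the presheaf represented by `[1]`. -/
abbrev interval (B : CubeCategory N) : CubicalSet B where
  carrier := pullback B.cod (N.zero ≫ N.succ)
  dim := pullback.fst _ _ ≫ B.dom
  res {T} x φ h := pullback.lift
    (B.comp φ (x ≫ pullback.fst _ _) (by rw [Category.assoc, h])) (terminal.from T) (by
      rw [B.comp_cod, Category.assoc, pullback.condition, ← Category.assoc,
        Subsingleton.elim (x ≫ pullback.snd _ _) (terminal.from T)])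
  res_dim x φ h := by rw [pullback.lift_fst_assoc, B.comp_dom]
  res_natural t x φ h := by
    apply pullback.hom_ext
    · simp only [Category.assoc, pullback.lift_fst, B.comp_natural]
    · exact Subsingleton.elim _ _
  res_id x := by
    apply pullback.hom_ext
    · rw [pullback.lift_fst]
      have := B.id_comp (x ≫ pullback.fst B.cod (N.zero ≫ N.succ))
      simpa only [Category.assoc] using this
    · exact Subsingleton.elim _ _
  res_comp x ψ φ h h' := by
    apply pullback.hom_ext
    · simp only [pullback.lift_fst]
      exact B.assoc _ _ _ _ _
    · exact Subsingleton.elim _ _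

/-- The unique map `[n] ⟶ [0]`, for a generalised element `n` of the natural numbers. -/
def bang (B : CubeCategory N) {T : E} (n : T ⟶ N.N) : T ⟶ B.Hom :=
  (B.exists_unique_bang n).choose

theorem bang_dom {T : E} (n : T ⟶ N.N) : bang B n ≫ B.dom = n :=
  (B.exists_unique_bang n).choose_spec.1.1

theorem bang_cod {T : E} (n : T ⟶ N.N) : bang B n ≫ B.cod = terminal.from T ≫ N.zero :=
  (B.exists_unique_bang n).choose_spec.1.2

theorem bang_eq {T : E} (f : T ⟶ B.Hom) (h : f ≫ B.cod = terminal.from T ≫ N.zero) :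
    f = bang B (f ≫ B.dom) :=
  (B.exists_unique_bang (f ≫ B.dom)).choose_spec.2 f ⟨rfl, h⟩

theorem cube_comp_congr {T : E} {f f' g g' : T ⟶ B.Hom} (hf : f = f') (hg : g = g')
    (h : f ≫ B.cod = g ≫ B.dom) (h' : f' ≫ B.cod = g' ≫ B.dom) :
    B.comp f g h = B.comp f' g' h' := by
  subst hf hg; rfl

/-- The constant map `A ⟶ yI` at the point of the interval given by `e : [0] ⟶ [1]`; it sends an
`n`-cube of `A` to the composite `[n] ⟶ [0] ⟶ [1]`. -/
def atPoint (A : CubicalSet B) (e : ⊤_ E ⟶ B.Hom) (h₀ : e ≫ B.dom = N.zero)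
    (h₁ : e ≫ B.cod = N.zero ≫ N.succ) : A ⟶ interval B where
  map := pullback.lift
    (B.comp (bang B A.dim) (terminal.from _ ≫ e) (by rw [bang_cod, Category.assoc, h₀]))
    (terminal.from _) (by rw [B.comp_cod, Category.assoc, h₁])
  map_dim := by
    change _ ≫ pullback.fst _ _ ≫ B.dom = _
    rw [pullback.lift_fst_assoc, B.comp_dom, bang_dom]
  map_res {T} x φ h := by
    apply pullback.hom_ext
    · have hx : (x ≫ bang B A.dim) ≫ B.dom = x ≫ A.dim := by rw [Category.assoc, bang_dom]
      have hc : (x ≫ bang B A.dim) ≫ B.cod = terminal.from T ≫ N.zero := by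
        rw [Category.assoc, bang_cod, ← Category.assoc]
        congr 1; exact Subsingleton.elim _ _
      have e₀ : φ ≫ B.cod = (x ≫ bang B A.dim) ≫ B.dom := by rw [hx, h]
      have e₁ : (x ≫ bang B A.dim) ≫ B.cod = (terminal.from T ≫ e) ≫ B.dom := by
        rw [hc, Category.assoc, h₀]
      have e₂ : A.res x φ h ≫ bang B A.dim = B.comp φ (x ≫ bang B A.dim) e₀ := by
        rw [bang_eq (A.res x φ h ≫ bang B A.dim) (by
            rw [Category.assoc, bang_cod, ← Category.assoc]
            congr 1; exact Subsingleton.elim _ _),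
          bang_eq (B.comp φ (x ≫ bang B A.dim) e₀) (by rw [B.comp_cod, hc])]
        congr 1
        rw [Category.assoc, bang_dom, A.res_dim, B.comp_dom]
      have e₃ := B.assoc φ (x ≫ bang B A.dim) (terminal.from T ≫ e) e₀ e₁
      have ht : ∀ {S : E} (y : S ⟶ A.carrier),
          y ≫ terminal.from A.carrier ≫ e = terminal.from S ≫ e := by
        intro S y
        rw [← Category.assoc]
        congr 1; exact Subsingleton.elim _ _
      have hb : bang B A.dim ≫ B.cod = (terminal.from A.carrier ≫ e) ≫ B.dom := by
        rw [bang_cod, Category.assoc, h₀]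
      have e₄ : ∀ {S : E} (y : S ⟶ A.carrier)
          (h' : (y ≫ bang B A.dim) ≫ B.cod = (terminal.from S ≫ e) ≫ B.dom),
          y ≫ B.comp (bang B A.dim) (terminal.from _ ≫ e) hb =
            B.comp (y ≫ bang B A.dim) (terminal.from S ≫ e) h' := by
        intro S y h'
        rw [B.comp_natural]
        exact cube_comp_congr rfl (ht y) _ _
      have l₁ : ∀ {S : E} (y : S ⟶ A.carrier) (w), (y ≫ pullback.lift
          (B.comp (bang B A.dim) (terminal.from _ ≫ e) hb) (terminal.from _) w) ≫
            pullback.fst B.cod (N.zero ≫ N.succ) =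
          y ≫ B.comp (bang B A.dim) (terminal.from _ ≫ e) hb := by
        intro S y w
        rw [Category.assoc, pullback.lift_fst]
      have h₂ : (A.res x φ h ≫ bang B A.dim) ≫ B.cod = (terminal.from T ≫ e) ≫ B.dom := by
        rw [e₂, B.comp_cod, e₁]
      refine (l₁ _ _).trans (Eq.trans ?_ (pullback.lift_fst _ _ _).symm)
      refine (e₄ _ h₂).trans ?_
      refine (cube_comp_congr e₂ rfl h₂ (by rw [B.comp_cod, e₁])).trans ?_
      refine e₃.trans (cube_comp_congr rfl ?_ _ _)
      exact ((l₁ _ _).trans (e₄ _ e₁)).symm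
    · exact Subsingleton.elim _ _

/-- The inclusion of `A` in the cylinder `yI × A` at the endpoint `0`. -/
def incl₀ (A : CubicalSet B) : A ⟶ interval B ⨯ A :=
  prod.lift (atPoint A B.end₀ B.end₀_dom B.end₀_cod) (𝟙 A)

/-- The inclusion of `A` in the cylinder `yI × A` at the endpoint `1`. -/
def incl₁ (A : CubicalSet B) : A ⟶ interval B ⨯ A :=
  prod.lift (atPoint A B.end₁ B.end₁_dom B.end₁_cod) (𝟙 A)

/-- Homotopy of maps of cubical sets: `f` and `g` are joined by a path. -/
def Homotopic {A X : CubicalSet B} (f g : A ⟶ X) : Prop :=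
  ∃ H : interval B ⨯ A ⟶ X, incl₀ A ≫ H = f ∧ incl₁ A ≫ H = g

/-- Homotopy over `Y`: the path lies over constant paths in `Y`. -/
def HomotopicOver {A X Y : CubicalSet B} (p : X ⟶ Y) (f g : A ⟶ X) : Prop :=
  ∃ H : interval B ⨯ A ⟶ X, incl₀ A ≫ H = f ∧ incl₁ A ≫ H = g ∧ H ≫ p = prod.snd ≫ f ≫ p

/-- `f : X ⟶ Y` is an h-proposition: `Path_Y(X) ⟶ X ×_Y X` has a section. By the adjunction
between `yI × (-)` and `(-)^I`, a section is a path over `Y` between the two projections. -/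
def IsHProp {X Y : CubicalSet B} (f : X ⟶ Y) : Prop :=
  HomotopicOver f (pullback.fst f f) (pullback.snd f f)

/-- Homotopy equivalence over `Y`. -/
def EquivOver {X X' Y : CubicalSet B} (f : X ⟶ Y) (f' : X' ⟶ Y) : Prop :=
  ∃ (i : X ⟶ X') (j : X' ⟶ X), i ≫ f' = f ∧ j ≫ f = f' ∧
    HomotopicOver f (i ≫ j) (𝟙 X) ∧ HomotopicOver f' (j ≫ i) (𝟙 X')

section HoTT

variable (Fib : MorphismProperty (CubicalSet B))

/-- `t` is the propositional truncation of `f` over `Y`: the universal fibration over `Y` which is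
an h-proposition and receives a map from `f`. -/
structure IsTruncation {X Y T : CubicalSet B} (f : X ⟶ Y) (t : T ⟶ Y) : Prop where
  fib : Fib t
  isHProp : IsHProp t
  unit : ∃ η : X ⟶ T, η ≫ t = f
  elim : ∀ ⦃P : CubicalSet B⦄ (p : P ⟶ Y), Fib p → IsHProp p →
    (∃ g : X ⟶ P, g ≫ p = f) → ∃ k : T ⟶ P, k ≫ p = t

/-- The type `‖X‖` in context `Y` has a term. -/
def MerelyInhabited {X Y : CubicalSet B} (f : X ⟶ Y) : Prop :=
  ∃ (T : CubicalSet B) (t : T ⟶ Y), IsTruncation Fib f t ∧ ∃ s : Y ⟶ T, s ≫ t = 𝟙 Y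

/-- `Fib` is a class of Kan fibrations by which cubical sets interpret homotopy type theory: types
in context `Y` are fibrations over `Y`, and terms are their sections. (That the initial object and
the natural number object `Δ N` are fibrant is the case of constant cubical sets.) -/
structure IsKanFibrationClass : Prop where
  /-- substitution -/
  baseChange : Fib.IsStableUnderBaseChange
  /-- `Σ`-types -/
  comp : ∀ ⦃X Y Z : CubicalSet B⦄ (f : X ⟶ Y) (g : Y ⟶ Z), Fib f → Fib g → Fib (f ≫ g)
  /-- `Π`-types -/
  depProd : ∀ ⦃X Y Z : CubicalSet B⦄ (f : X ⟶ Y) (g : Y ⟶ Z), Fib f → Fib g →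
    ∃ (P : CubicalSet B) (p : P ⟶ Z), IsDepProd f g p ∧ Fib p
  /-- maps between constant cubical sets are fibrations -/
  const : ∀ ⦃S T : E⦄ (f : (const B).obj S ⟶ (const B).obj T), Fib f
  /-- for every point `d` of the interval, `A ⟶ yI × A` is a trivial cofibration; since this is a
  statement of the metatheory, it is required for `T`-indexed families of points `d` and of cubical
  sets `A`, for every object `T` of the metatheory -/
  hurewicz : ∀ ⦃T : E⦄ ⦃A : CubicalSet B⦄ (t : A ⟶ (CubicalSet.const B).obj T)
    (d : (CubicalSet.const B).obj T ⟶ interval B) ⦃X Y : CubicalSet B⦄ (f : X ⟶ Y), Fib f →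
    HasLiftingProperty (prod.lift (t ≫ d) (𝟙 A)) f
  /-- types have propositional truncations, which are preserved by reindexing -/
  truncation : ∀ ⦃X Y : CubicalSet B⦄ (f : X ⟶ Y), Fib f →
    ∃ (T : CubicalSet B) (t : T ⟶ Y), IsTruncation Fib f t ∧
      ∀ ⦃Z : CubicalSet B⦄ (z : Z ⟶ Y), IsTruncation Fib (pullback.snd f z) (pullback.snd t z)

variable (q : Rationals N)

/-- The type of rational numbers in cubical sets (`Δ` preserves the natural numbers, finite limits
and quotients). -/
abbrev rat (B : CubeCategory N) (q : Rationals N) : CubicalSet B := (CubicalSet.const B).obj q.Q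

/-- The context of pairs `a < b` of rational numbers over `Y`. -/
abbrev ltCtx (q : Rationals N) (Y : CubicalSet B) : CubicalSet B :=
  Y ⨯ (CubicalSet.const B).obj q.Lt

/-- `(y, a < b) ↦ (y, a)`. -/
abbrev lower (q : Rationals N) (Y : CubicalSet B) : ltCtx q Y ⟶ Y ⨯ rat B q :=
  prod.map (𝟙 Y) ((CubicalSet.const B).map q.ltFst)

/-- `(y, a < b) ↦ (y, b)`. -/
abbrev upper (q : Rationals N) (Y : CubicalSet B) : ltCtx q Y ⟶ Y ⨯ rat B q :=
  prod.map (𝟙 Y) ((CubicalSet.const B).map q.ltSnd)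

variable {q} {Y D : CubicalSet B}

/-- Boundedness, in context `Y`: `‖Σ (a b : Q), ¬ D a × D b‖`. -/
def IsBounded (d : D ⟶ Y ⨯ rat B q) : Prop :=
  ∃ (M : CubicalSet B) (n : M ⟶ Y ⨯ rat B q), IsNegation d n ∧
    MerelyInhabited Fib
      (pullback.fst (n ≫ prod.fst) (d ≫ prod.fst) ≫ n ≫ prod.fst)

/-- Closedness, in context `Y`: `Π (a : Q), (Π (b : Q), a < b → D b) → D a`. -/
def IsClosedCut (d : D ⟶ Y ⨯ rat B q) : Prop :=
  ∃ (G : CubicalSet B) (g : G ⟶ Y ⨯ rat B q),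
    IsDepProd (pullback.snd d (upper q Y)) (lower q Y) g ∧ ∃ k : G ⟶ D, k ≫ d = g

/-- Locatedness, in context `Y`: `Π (a b : Q), a < b → ‖¬ D a + D b‖`. -/
def IsLocated (d : D ⟶ Y ⨯ rat B q) : Prop :=
  ∃ (M : CubicalSet B) (n : M ⟶ Y ⨯ rat B q), IsNegation d n ∧
    ∃ (c : BinaryCofan (pullback n (lower q Y)) (pullback d (upper q Y))) (s : c.pt ⟶ ltCtx q Y),
      Nonempty (IsColimit c) ∧ c.inl ≫ s = pullback.snd n (lower q Y) ∧
      c.inr ≫ s = pullback.snd d (upper q Y) ∧ MerelyInhabited Fib s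

/-- `D` is a cocut in context `Y`: a family of h-propositions on the rationals which is bounded,
closed and located. -/
structure IsCocut (d : D ⟶ Y ⨯ rat B q) : Prop where
  fib : Fib d
  isHProp : IsHProp d
  bounded : IsBounded Fib d
  closed : IsClosedCut d
  located : IsLocated Fib d

/-- The closed type `R`, with the family `c` of cocuts over it, is the type of all Dedekind real
numbers: in every context `Y`, every cocut is equivalent to the one named by an element of `R`, and
that element is unique up to a path. -/
structure IsTypeOfDedekindReals {R K : CubicalSet B} (c : K ⟶ R ⨯ rat B q) : Prop where
  fibrant : Fib (terminal.from R)
  isCocut : IsCocut Fib c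
  exists_classifying : ∀ ⦃Y D : CubicalSet B⦄ (d : D ⟶ Y ⨯ rat B q), IsCocut Fib d →
    ∃ χ : Y ⟶ R, EquivOver d (pullback.snd c (prod.map χ (𝟙 (rat B q))))
  unique : ∀ ⦃Y : CubicalSet B⦄ (χ χ' : Y ⟶ R),
    EquivOver (pullback.snd c (prod.map χ (𝟙 (rat B q))))
      (pullback.snd c (prod.map χ' (𝟙 (rat B q)))) → Homotopic χ χ'

end HoTT

end CubicalSet

end CubicalSets

end

end CubicalReals

/-! A cocut is equivalent to data that a classifier in `E` can see. Suppose `¬¬D(a)` and `a < b`.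
Locatedness gives `¬D(a)` or `D(b)`; the first is absurd, so `D(b)` holds for all `b > a`, and
closedness gives `D(a)`. Hence a cocut is logically equivalent to its double negation
(`IsCocut.exists_notNot`), and a negation is always a monomorphism, even though `D` is only an
h-proposition.

A monic fibration is moreover invariant along cubes. A cube is an iterated cylinder, and fibrations
lift against the inclusion of any point in a cylinder, so a cube of the base belongs to the
subobject as soon as one of its restrictions does (`IsKanFibrationClass.fac_of_res`). Therefore the
carrier of `¬¬D` is a `¬¬`-stable subobject in `E` (`isNotNotStable_map`). Its characteristic map to
`Ω`, transposed to a map from the carrier of `Y` to `P = Ω^Q`, is unchanged by restriction, so it is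
a map of cubical sets `Y ⟶ Δ P`. Cocuts are thus classified by maps to a constant cubical set, and
these maps are unique on the nose (`IsCocut.exists_classify`, `classify_unique`).

The universal family `κ` over `Δ P × Δ Q` comes from a map in `E`, so it is a fibration.
Boundedness, closedness and locatedness of `κ` are fibrant h-propositions over `Δ P`; their
conjunction is `ρ : R ⟶ Δ P`, and the universal cocut is the pullback of `κ` along `ρ`. The
classifying map of a cocut factors through `ρ` because the three conditions are compatible with
reindexing. If two maps to `R` name equivalent cocuts, their composites with `ρ` are equal, and they
are homotopic because `ρ` is an h-proposition; truncations need not be monic, so equality is not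
claimed.

The logic is handled by forcing: `Fac w d` says that `d` is inhabited at the generalised element
`w`, and negations and dependent products acquire Kripke–Joyal clauses. -/

namespace CubicalReals

attribute [local simp] prod.lift_fst prod.lift_snd prod.lift_fst_assoc prod.lift_snd_assoc
  pullback.lift_fst pullback.lift_snd pullback.lift_fst_assoc pullback.lift_snd_assoc

noncomputable section

/-! ### Forcing with generalised elements: dependent products, negation, `¬¬`-stability. -/

section Forcing

variable {C : Type u} [Category.{v} C]

/-- `w` factors through `d`. -/
def Fac {W X Y : C} (w : W ⟶ Y) (d : X ⟶ Y) : Prop := ∃ e : W ⟶ X, e ≫ d = w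

/-- `S` is an initial object. -/
def IsInit (S : C) : Prop := Nonempty (IsInitial S)

theorem Fac.refl {X Y : C} (d : X ⟶ Y) : Fac d d := ⟨𝟙 _, Category.id_comp _⟩

theorem Fac.precomp {S W X Y : C} {w : W ⟶ Y} {d : X ⟶ Y} (h : Fac w d) (s : S ⟶ W) :
    Fac (s ≫ w) d := by
  obtain ⟨e, rfl⟩ := h
  exact ⟨s ≫ e, Category.assoc _ _ _⟩

theorem Fac.trans {W X X' Y : C} {w : W ⟶ Y} {d : X ⟶ Y} {d' : X' ⟶ Y} (h : Fac w d)
    (h' : Fac d d') : Fac w d' := by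
  obtain ⟨e, rfl⟩ := h
  exact h'.precomp e

theorem fac_snd_iff [HasPullbacks C] {W X Y Z : C} (w : W ⟶ Z) (d : X ⟶ Y) (z : Z ⟶ Y) :
    Fac w (pullback.snd d z) ↔ Fac (w ≫ z) d := by
  constructor
  · rintro ⟨e, rfl⟩
    exact ⟨e ≫ pullback.fst d z, by simp [pullback.condition]⟩
  · rintro ⟨e, he⟩
    exact ⟨pullback.lift e w he, by simp⟩

theorem fac_comp_iff {W X Y Z : C} (w : W ⟶ Z) (f : X ⟶ Y) (g : Y ⟶ Z) :
    Fac w (f ≫ g) ↔ ∃ y : W ⟶ Y, y ≫ g = w ∧ Fac y f := by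
  constructor
  · rintro ⟨e, rfl⟩
    exact ⟨e ≫ f, Category.assoc _ _ _, e, rfl⟩
  · rintro ⟨y, rfl, e, rfl⟩
    exact ⟨e, (Category.assoc _ _ _).symm⟩

/-- Representability unpacked through the image of the identity, which is evaluation. Equality of
maps to the dependent product can then be tested on pairs of generalised elements. -/
theorem IsDepProd.exists_ev [HasPullbacks C] {X Y Z P : C} {f : X ⟶ Y} {g : Y ⟶ Z} {p : P ⟶ Z}
    (h : IsDepProd f g p) : ∃ ev : pullback p g ⟶ X, ev ≫ f = pullback.snd p g ∧
      (∀ ⦃W : C⦄ (w : W ⟶ Z) (l : pullback w g ⟶ X), l ≫ f = pullback.snd w g →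
        ∃ (k : W ⟶ P) (hk : k ≫ p = w), pullback.lift (pullback.fst w g ≫ k) (pullback.snd w g)
          (by rw [Category.assoc, hk, pullback.condition]) ≫ ev = l) ∧
      ∀ ⦃W : C⦄ (k k' : W ⟶ P), k ≫ p = k' ≫ p →
        (∀ ⦃S : C⦄ (s : S ⟶ W) (y : S ⟶ Y) (hy : (s ≫ k) ≫ p = y ≫ g)
          (hy' : (s ≫ k') ≫ p = y ≫ g),
          pullback.lift (s ≫ k) y hy ≫ ev = pullback.lift (s ≫ k') y hy' ≫ ev) → k = k' := by
  obtain ⟨r⟩ := h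
  let ev : (Over.pullback g).obj (Over.mk p) ⟶ Over.mk f := r.homEquiv (𝟙 _)
  have key : ∀ {W : C} (w : W ⟶ Z) (k : Over.mk w ⟶ Over.mk p),
      r.homEquiv k = (Over.pullback g).map k ≫ ev := by
    intro W w k
    have := r.homEquiv_comp k (𝟙 _)
    rwa [Category.comp_id] at this
  have key' : ∀ {W : C} (w : W ⟶ Z) (k : W ⟶ P) (hk : k ≫ p = w),
      (r.homEquiv (X := Over.mk w) (Over.homMk k hk)).left =
        pullback.lift (pullback.fst w g ≫ k) (pullback.snd w g)
          (by rw [Category.assoc]; exact hk ▸ pullback.condition) ≫ ev.left := by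
    intro W w k hk
    rw [key]
    rfl
  refine ⟨ev.left, Over.w ev, ?_, ?_⟩
  · intro W w l hl
    let l' : (Over.pullback g).obj (Over.mk w) ⟶ Over.mk f := Over.homMk l hl
    let k := r.homEquiv.symm l'
    refine ⟨k.left, Over.w k, ?_⟩
    refine (key' w k.left (Over.w k)).symm.trans ?_
    have : (Over.homMk k.left (Over.w k) : Over.mk w ⟶ Over.mk p) = k := rfl
    rw [this]
    simp only [k, Equiv.apply_symm_apply]
    rfl
  · intro W k k' hk H
    have : (Over.homMk k rfl : Over.mk (k ≫ p) ⟶ Over.mk p) = Over.homMk k' hk.symm := by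
      apply r.homEquiv.injective
      apply Over.OverMorphism.ext
      rw [key', key']
      exact H (pullback.fst (k ≫ p) g) (pullback.snd (k ≫ p) g)
        (by rw [Category.assoc, pullback.condition])
        (by rw [Category.assoc, ← hk, pullback.condition])
    exact congrArg CommaMorphism.left this

/-- The Kripke–Joyal clause for a universal quantifier. For the converse, the generic instance over
`pullback w g` suffices, so `f` need not be monic. -/
theorem IsDepProd.fac_iff [HasPullbacks C] {X Y Z P : C} {f : X ⟶ Y} {g : Y ⟶ Z} {p : P ⟶ Z}
    (h : IsDepProd f g p) {W : C} (w : W ⟶ Z) :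
    Fac w p ↔ ∀ ⦃S : C⦄ (s : S ⟶ W) (y : S ⟶ Y), s ≫ w = y ≫ g → Fac y f := by
  obtain ⟨ev, hev, h₁, -⟩ := h.exists_ev
  constructor
  · rintro ⟨k, rfl⟩ S s y hy
    exact ⟨pullback.lift (s ≫ k) y (by rw [Category.assoc, hy]) ≫ ev, by
      rw [Category.assoc, hev, pullback.lift_snd]⟩
  · intro H
    obtain ⟨l, hl⟩ := H (pullback.fst w g) (pullback.snd w g) pullback.condition
    obtain ⟨k, hk, -⟩ := h₁ w l hl
    exact ⟨k, hk⟩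

theorem IsDepProd.mono [HasPullbacks C] {X Y Z P : C} {f : X ⟶ Y} {g : Y ⟶ Z} {p : P ⟶ Z}
    (h : IsDepProd f g p) [Mono f] : Mono p := by
  obtain ⟨ev, hev, -, h₂⟩ := h.exists_ev
  refine ⟨fun {W} k k' hk => h₂ k k' hk fun S s y hy hy' => ?_⟩
  rw [← cancel_mono f, Category.assoc, Category.assoc, hev, pullback.lift_snd, pullback.lift_snd]

theorem LocallyCartesianClosed.exists_depProd [HasPullbacks C] (hC : LocallyCartesianClosed C)
    {X Y Z : C} (f : X ⟶ Y) (g : Y ⟶ Z) : ∃ (P : C) (p : P ⟶ Z), IsDepProd f g p := by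
  have := hC g
  let adj := Adjunction.ofIsLeftAdjoint (Over.pullback g)
  let G := (Over.pullback g).rightAdjoint
  refine ⟨(G.obj (Over.mk f)).left, (G.obj (Over.mk f)).hom, ⟨?_⟩⟩
  exact
    { homEquiv := fun {W} => (adj.homEquiv W (Over.mk f)).symm
      homEquiv_comp := fun k l => adj.homEquiv_naturality_left_symm k l }

theorem IsInit.of_hom [HasStrictInitialObjects C] {S T : C} (f : S ⟶ T) (h : IsInit T) :
    IsInit S := by
  obtain ⟨h⟩ := h
  have := h.isIso_to f
  exact ⟨h.ofIso (asIso f).symm⟩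

theorem isInit_iff [HasStrictInitialObjects C] {O S X : C} (hO : IsInitial O) (x : S ⟶ X) :
    Fac x (hO.to X) ↔ IsInit S := by
  constructor
  · rintro ⟨e, -⟩
    exact IsInit.of_hom e ⟨hO⟩
  · rintro ⟨h⟩
    exact ⟨h.to O, h.hom_ext _ _⟩

theorem mono_initial_to [HasStrictInitialObjects C] {O X : C} (hO : IsInitial O) :
    Mono (hO.to X) :=
  ⟨fun {W} a _ _ => by
    obtain ⟨h⟩ := IsInit.of_hom a ⟨hO⟩
    exact h.hom_ext _ _⟩

theorem LocallyCartesianClosed.exists_negation [HasPullbacks C] [HasInitial C] (hC : LocallyCartesianClosed C)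
    {X Y : C} (f : X ⟶ Y) : ∃ (M : C) (n : M ⟶ Y), IsNegation f n := by
  obtain ⟨P, p, h⟩ := hC.exists_depProd (initialIsInitial.to X) f
  exact ⟨P, p, _, initialIsInitial, h⟩

section Negation

variable [HasPullbacks C] [HasStrictInitialObjects C]

/-- Since initial objects are strict, the empty family has an element at a stage only if that stage
is initial. -/
theorem IsNegation.fac_iff {X Y M : C} {f : X ⟶ Y} {n : M ⟶ Y} (h : IsNegation f n) {W : C}
    (w : W ⟶ Y) : Fac w n ↔ ∀ ⦃S : C⦄ (s : S ⟶ W), Fac (s ≫ w) f → IsInit S := by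
  obtain ⟨O, hO, h⟩ := h
  rw [h.fac_iff]
  constructor
  · rintro H S s ⟨x, hx⟩
    exact (isInit_iff hO x).1 (H s x hx.symm)
  · intro H S s x hx
    exact (isInit_iff hO x).2 (H s ⟨x, hx.symm⟩)

theorem IsNegation.mono {X Y M : C} {f : X ⟶ Y} {n : M ⟶ Y} (h : IsNegation f n) : Mono n := by
  obtain ⟨O, hO, h⟩ := h
  have := mono_initial_to (X := X) hO
  exact h.mono

/-- Stability under double negation in terms of generalised elements. -/
theorem isNotNotStable_iff [HasInitial C] (hC : LocallyCartesianClosed C) {X Y : C} (f : X ⟶ Y) :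
    IsNotNotStable f ↔ ∀ ⦃W : C⦄ (w : W ⟶ Y),
      (∀ ⦃S : C⦄ (s : S ⟶ W), (∀ ⦃S' : C⦄ (s' : S' ⟶ S), Fac (s' ≫ s ≫ w) f → IsInit S') →
        IsInit S) → Fac w f := by
  constructor
  · rintro ⟨M, M', n, n', hn, hn', hk⟩ W w H
    refine Fac.trans (d := n') ?_ hk
    rw [hn'.fac_iff]
    intro S s hs
    rw [hn.fac_iff] at hs
    exact H s hs
  · intro H
    obtain ⟨M, n, hn⟩ := hC.exists_negation f
    obtain ⟨M', n', hn'⟩ := hC.exists_negation n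
    refine ⟨M, M', n, n', hn, hn', H n' fun S s hs => ?_⟩
    exact (hn'.fac_iff n').1 (Fac.refl _) s ((hn.fac_iff _).2 hs)

end Negation

/-- Monicity supplies uniqueness and compatibility of the other leg, so a pullback square reduces to
an implication between memberships. -/
theorem isPullback_of_mono_of_fac {P X Y Z : C} {fst : P ⟶ X} {snd : P ⟶ Y} {f : X ⟶ Z}
    {g : Y ⟶ Z} (w : fst ≫ f = snd ≫ g) [Mono f] [Mono snd]
    (h : ∀ ⦃T : C⦄ (y : T ⟶ Y), Fac (y ≫ g) f → Fac y snd) : IsPullback fst snd f g := by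
  refine ⟨⟨w⟩, ⟨PullbackCone.IsLimit.mk w (fun s => (h s.snd ⟨s.fst, s.condition⟩).choose)
    (fun s => ?_) (fun s => (h s.snd ⟨s.fst, s.condition⟩).choose_spec) fun s k _ hk => ?_⟩⟩
  · rw [← cancel_mono f, Category.assoc, w, s.condition, ← Category.assoc,
      (h s.snd ⟨s.fst, s.condition⟩).choose_spec]
  · rw [← cancel_mono snd, hk, (h s.snd ⟨s.fst, s.condition⟩).choose_spec]

end Forcing

/-! ### Powers, extensionality for `Ω`, and induction on the natural number object. -/

section Classifier

variable {C : Type u} [Category.{v} C] [HasFiniteLimits C]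

/-- Cartesian closure: powers of `A` by `Q`. -/
theorem LocallyCartesianClosed.exists_power (hC : LocallyCartesianClosed C) (A Q : C) :
    ∃ (P : C) (ev : P ⨯ Q ⟶ A), ∀ ⦃T : C⦄ (h : T ⨯ Q ⟶ A),
      ∃! k : T ⟶ P, prod.map k (𝟙 Q) ≫ ev = h := by
  obtain ⟨P, p, hp⟩ := hC.exists_depProd (prod.snd : A ⨯ Q ⟶ Q) (terminal.from Q)
  obtain ⟨ev, hev, h₁, h₂⟩ := hp.exists_ev
  let i : P ⨯ Q ⟶ pullback p (terminal.from Q) :=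
    pullback.lift prod.fst prod.snd (Subsingleton.elim _ _)
  have hi : ∀ {S : C} (a : S ⟶ P) (b : S ⟶ Q) (w), pullback.lift a b w = prod.lift a b ≫ i := by
    intro S a b w
    apply pullback.hom_ext <;> simp [i]
  refine ⟨P, i ≫ ev ≫ prod.fst, fun T h => ?_⟩
  obtain ⟨k, hk₀, hk⟩ := h₁ (terminal.from T)
    (prod.lift (prod.lift (pullback.fst _ _) (pullback.snd _ _) ≫ h) (pullback.snd _ _)) (by simp)
  have hE : prod.map k (𝟙 Q) ≫ i ≫ ev ≫ prod.fst = h := by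
    have := congrArg (fun t => (pullback.lift prod.fst prod.snd (Subsingleton.elim _ _) :
      T ⨯ Q ⟶ pullback (terminal.from T) (terminal.from Q)) ≫ t ≫ prod.fst) hk
    simp only [hi, Category.assoc, prod.lift_fst] at this
    have e₁ : (pullback.lift prod.fst prod.snd (Subsingleton.elim _ _) :
        T ⨯ Q ⟶ pullback (terminal.from T) (terminal.from Q)) ≫
          prod.lift (pullback.fst _ _ ≫ k) (pullback.snd _ _) = prod.map k (𝟙 Q) := by
      apply Limits.prod.hom_ext <;> simp
    have e₂ : (pullback.lift prod.fst prod.snd (Subsingleton.elim _ _) :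
        T ⨯ Q ⟶ pullback (terminal.from T) (terminal.from Q)) ≫
          prod.lift (pullback.fst _ _) (pullback.snd _ _) = 𝟙 _ := by
      apply Limits.prod.hom_ext <;> simp
    rw [← e₁, Category.assoc, this, ← Category.assoc, e₂, Category.id_comp]
  refine ⟨k, hE, fun k' hk' => ?_⟩
  apply h₂ _ _ (Subsingleton.elim _ _)
  intro S s y hy hy'
  have e : ∀ k : T ⟶ P, prod.lift (s ≫ k) y = prod.lift s y ≫ prod.map k (𝟙 Q) := by
    intro k
    rw [prod.lift_map, Category.comp_id]
  apply Limits.prod.hom_ext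
  · rw [hi, hi, e, e]
    simp only [Category.assoc, hk', hE]
  · rw [Category.assoc, Category.assoc, hev, pullback.lift_snd, pullback.lift_snd]

theorem IsNotNotStable.pullback_snd [HasStrictInitialObjects C] [HasInitial C]
    (hC : LocallyCartesianClosed C) {X Y Z : C} {f : X ⟶ Y} (hf : IsNotNotStable f) (z : Z ⟶ Y) :
    IsNotNotStable (pullback.snd f z) := by
  rw [isNotNotStable_iff hC] at hf ⊢
  simp only [fac_snd_iff]
  intro W w H
  apply hf
  simpa only [Category.assoc] using H

/-- Maps to `Ω` are determined by the subobjects they classify. -/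
theorem IsNotNotStableClassifier.hom_ext [HasStrictInitialObjects C] [HasInitial C]
    (hC : LocallyCartesianClosed C) {Ω : C} {m : ⊤_ C ⟶ Ω} (hm : IsNotNotStableClassifier m)
    {X : C} (h h' : X ⟶ Ω) (H : ∀ ⦃S : C⦄ (s : S ⟶ X), Fac (s ≫ h) m ↔ Fac (s ≫ h') m) :
    h = h' := by
  have hmono : Mono m := ⟨fun _ _ _ => Subsingleton.elim _ _⟩
  have h₁ : IsPullback (terminal.from _) (pullback.snd m h) m h := by
    rw [Subsingleton.elim (terminal.from _) (pullback.fst m h)]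
    exact IsPullback.of_hasPullback m h
  obtain ⟨χ, -, hχ⟩ := hm.classify (pullback.snd m h) inferInstance
    (hm.stable.pullback_snd hC h)
  -- Both maps are shown to classify the subobject obtained by pulling `m` back along `h`.
  rw [hχ h h₁, hχ h']
  obtain ⟨e, he⟩ := (H (pullback.snd m h)).1 ⟨pullback.fst m h, pullback.condition⟩
  refine isPullback_of_mono_of_fac ?_ fun T y hy => ?_
  · rw [← he, Subsingleton.elim e (terminal.from _)]
  · rw [fac_snd_iff]
    exact (H y).2 hy

/-- Induction over a natural number object. -/
theorem NNO.fac_id_of_mono (N : NNO C) {S : C} (i : S ⟶ N.N) [Mono i] (h₀ : Fac N.zero i)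
    (h₁ : Fac (i ≫ N.succ) i) : Fac (𝟙 N.N) i := by
  obtain ⟨a, ha⟩ := h₀
  obtain ⟨s, hs⟩ := h₁
  -- Recursion inside `S`, followed by `i`, satisfies the recursion equations of the identity of
  -- `N`, and so gives a section of `i`.
  obtain ⟨r, ⟨hr, hr'⟩, -⟩ := N.exists_unique_rec a s
  have := (N.exists_unique_rec N.zero N.succ).unique (y₁ := r ≫ i) (y₂ := prod.snd)
    ⟨by rw [← Category.assoc, hr, ha], by rw [← Category.assoc, hr', Category.assoc, hs,
      Category.assoc]⟩
    ⟨by simp [Subsingleton.elim (terminal.from (⊤_ C)) (𝟙 _)], by simp⟩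
  exact ⟨prod.lift (terminal.from _) (𝟙 _) ≫ r, by rw [Category.assoc, this, prod.lift_snd]⟩

end Classifier

/-! ### Stability of coproducts under pullback. -/

section Extensive

variable {E : Type u} [Category.{v} E] [FinitaryExtensive E]

theorem isColimit_of_isPullback {X Y S X' Y' S' : E} {i : X ⟶ S} {j : Y ⟶ S}
    (h : Nonempty (IsColimit (BinaryCofan.mk i j))) {i' : X' ⟶ S'} {j' : Y' ⟶ S'} {f : S' ⟶ S}
    {a : X' ⟶ X} {b : Y' ⟶ Y} (hi : IsPullback i' a f i) (hj : IsPullback j' b f j) :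
    Nonempty (IsColimit (BinaryCofan.mk i' j')) :=
  ((BinaryCofan.isVanKampen_iff _).1 (FinitaryExtensive.vanKampen _ h.some)
    (BinaryCofan.mk i' j') a b f hi.w.symm hj.w.symm).2 ⟨hi, hj⟩

end Extensive

/-! ### Pairing of arrows in the category of cubes. -/

section Cubes

variable {E : Type u} [Category.{v} E] [HasFiniteLimits E] {N : NNO E} (B : CubeCategory N)

namespace CubeCategory

/-- The map `[k] ⟶ [n + 1]` with components `f : [k] ⟶ [n]` and `g : [k] ⟶ [1]`. -/
def pair {T : E} (f g : T ⟶ B.Hom) (h : f ≫ B.dom = g ≫ B.dom)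
    (h' : g ≫ B.cod = terminal.from T ≫ N.zero ≫ N.succ) : T ⟶ B.Hom :=
  (B.exists_unique_pair f g h h').choose

variable {B} {T : E}

section

variable {f g : T ⟶ B.Hom} (h : f ≫ B.dom = g ≫ B.dom)
    (h' : g ≫ B.cod = terminal.from T ≫ N.zero ≫ N.succ)

theorem pair_cod : B.pair f g h h' ≫ B.cod = f ≫ B.cod ≫ N.succ :=
  (B.exists_unique_pair f g h h').choose_spec.1.choose

theorem comp_pair_fst : B.comp (B.pair f g h h') (f ≫ B.cod ≫ B.fst)
    (by simp only [Category.assoc, B.fst_dom, pair_cod]) = f :=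
  (B.exists_unique_pair f g h h').choose_spec.1.choose_spec.1

theorem comp_pair_snd : B.comp (B.pair f g h h') (f ≫ B.cod ≫ B.snd)
    (by simp only [Category.assoc, B.snd_dom, pair_cod]) = g :=
  (B.exists_unique_pair f g h h').choose_spec.1.choose_spec.2

theorem pair_dom : B.pair f g h h' ≫ B.dom = f ≫ B.dom := by
  conv_rhs => rw [← comp_pair_fst h h']
  rw [B.comp_dom]

end

theorem pair_ext {n : T ⟶ N.N} {p p' : T ⟶ B.Hom} (h : p ≫ B.cod = n ≫ N.succ)
    (h' : p' ≫ B.cod = n ≫ N.succ)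
    (hf : B.comp p (n ≫ B.fst) (by rw [h, Category.assoc, B.fst_dom]) =
      B.comp p' (n ≫ B.fst) (by rw [h', Category.assoc, B.fst_dom]))
    (hs : B.comp p (n ≫ B.snd) (by rw [h, Category.assoc, B.snd_dom]) =
      B.comp p' (n ≫ B.snd) (by rw [h', Category.assoc, B.snd_dom])) : p = p' := by
  have e₁ : p ≫ B.cod = (n ≫ B.fst) ≫ B.dom := by rw [h, Category.assoc, B.fst_dom]
  have e₂ : p ≫ B.cod = (n ≫ B.snd) ≫ B.dom := by rw [h, Category.assoc, B.snd_dom]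
  have hn : B.comp p (n ≫ B.fst) e₁ ≫ B.cod = n := by
    rw [B.comp_cod, Category.assoc, B.fst_cod, Category.comp_id]
  have ef : B.comp p (n ≫ B.fst) e₁ ≫ B.cod ≫ B.fst = n ≫ B.fst := by
    rw [← Category.assoc, hn]
  have es : B.comp p (n ≫ B.fst) e₁ ≫ B.cod ≫ B.snd = n ≫ B.snd := by
    rw [← Category.assoc, hn]
  have ht : (n ≫ B.snd) ≫ B.cod = terminal.from T ≫ N.zero ≫ N.succ := by
    rw [Category.assoc, B.snd_cod, ← Category.assoc]
    congr 1; exact Subsingleton.elim _ _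
  refine (B.exists_unique_pair (B.comp p (n ≫ B.fst) e₁) (B.comp p (n ≫ B.snd) e₂)
    (by rw [B.comp_dom, B.comp_dom]) (by rw [B.comp_cod, ht])).unique
    ⟨?_, ?_, ?_⟩ ⟨?_, ?_, ?_⟩
  · rw [← Category.assoc, hn, h]
  · exact CubicalSet.cube_comp_congr rfl ef _ _
  · exact CubicalSet.cube_comp_congr rfl es _ _
  · rw [← Category.assoc, hn, h']
  · exact (CubicalSet.cube_comp_congr rfl ef _ _).trans hf.symm
  · exact (CubicalSet.cube_comp_congr rfl es _ _).trans hs.symm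

theorem comp_pair {f g φ : T ⟶ B.Hom} (h : f ≫ B.dom = g ≫ B.dom)
    (h' : g ≫ B.cod = terminal.from T ≫ N.zero ≫ N.succ) (e : φ ≫ B.cod = f ≫ B.dom) :
    B.comp φ (B.pair f g h h') (by rw [pair_dom, e]) =
      B.pair (B.comp φ f e) (B.comp φ g (by rw [e, h]))
        (by rw [B.comp_dom, B.comp_dom]) (by rw [B.comp_cod, h']) := by
  have hc : B.comp φ f e ≫ B.cod = f ≫ B.cod := B.comp_cod _ _ _
  refine pair_ext (n := f ≫ B.cod) ?_ ?_ ?_ ?_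
  · rw [B.comp_cod, pair_cod, Category.assoc]
  · rw [pair_cod, ← Category.assoc, hc]
  · rw [B.assoc φ _ _ (by rw [pair_dom, e])
      (by simp only [Category.assoc, B.fst_dom, pair_cod])]
    refine (CubicalSet.cube_comp_congr rfl ?_ _ (by rw [e])).trans
      (Eq.trans (comp_pair_fst (f := B.comp φ f e) ?_ ?_).symm
        (CubicalSet.cube_comp_congr rfl ?_ _ _))
    · refine Eq.trans ?_ (comp_pair_fst h h')
      exact CubicalSet.cube_comp_congr rfl (Category.assoc _ _ _) _ _
    · rw [B.comp_dom, B.comp_dom]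
    · rw [B.comp_cod, h']
    · rw [← Category.assoc, hc]
  · rw [B.assoc φ _ _ (by rw [pair_dom, e])
      (by simp only [Category.assoc, B.snd_dom, pair_cod])]
    refine (CubicalSet.cube_comp_congr rfl ?_ _ (by rw [e, h])).trans
      (Eq.trans (comp_pair_snd (f := B.comp φ f e) ?_ ?_).symm
        (CubicalSet.cube_comp_congr rfl ?_ _ _))
    · refine Eq.trans ?_ (comp_pair_snd h h')
      exact CubicalSet.cube_comp_congr rfl (Category.assoc _ _ _) _ _
    · rw [B.comp_dom, B.comp_dom]
    · rw [B.comp_cod, h']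
    · rw [← Category.assoc, hc]

theorem pair_congr {f g f' g' : T ⟶ B.Hom} (hf : f = f') (hg : g = g')
    (h : f ≫ B.dom = g ≫ B.dom) (h' : g ≫ B.cod = terminal.from T ≫ N.zero ≫ N.succ)
    (k : f' ≫ B.dom = g' ≫ B.dom) (k' : g' ≫ B.cod = terminal.from T ≫ N.zero ≫ N.succ) :
    B.pair f g h h' = B.pair f' g' k k' := by
  subst hf hg; rfl

theorem precomp_pair {S : E} (t : S ⟶ T) {f g : T ⟶ B.Hom} (h : f ≫ B.dom = g ≫ B.dom)
    (h' : g ≫ B.cod = terminal.from T ≫ N.zero ≫ N.succ) :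
    t ≫ B.pair f g h h' = B.pair (t ≫ f) (t ≫ g) (by rw [Category.assoc, h, Category.assoc])
      (by rw [Category.assoc, h', ← Category.assoc, Subsingleton.elim (t ≫ _)]) := by
  have c₁ : B.pair f g h h' ≫ B.cod = (f ≫ B.cod ≫ B.fst) ≫ B.dom := by
    simp only [Category.assoc, B.fst_dom, pair_cod]
  have c₂ : B.pair f g h h' ≫ B.cod = (f ≫ B.cod ≫ B.snd) ≫ B.dom := by
    simp only [Category.assoc, B.snd_dom, pair_cod]
  refine pair_ext (n := t ≫ f ≫ B.cod) ?_ ?_ ?_ ?_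
  · simp only [Category.assoc, pair_cod]
  · simp only [Category.assoc, pair_cod]
  · refine Eq.trans ?_ (Eq.trans (comp_pair_fst (f := t ≫ f) (g := t ≫ g) ?_ ?_).symm
      (CubicalSet.cube_comp_congr rfl (by simp only [Category.assoc]) _ _))
    · refine Eq.trans ?_ (congrArg (t ≫ ·) (comp_pair_fst h h'))
      refine Eq.trans ?_ (B.comp_natural t _ _ c₁).symm
      exact CubicalSet.cube_comp_congr rfl (by simp only [Category.assoc]) _ _
    · rw [Category.assoc, h, Category.assoc]
    · rw [Category.assoc, h', ← Category.assoc, Subsingleton.elim (t ≫ _)]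
  · refine Eq.trans ?_ (Eq.trans (comp_pair_snd (f := t ≫ f) (g := t ≫ g) ?_ ?_).symm
      (CubicalSet.cube_comp_congr rfl (by simp only [Category.assoc]) _ _))
    · refine Eq.trans ?_ (congrArg (t ≫ ·) (comp_pair_snd h h'))
      refine Eq.trans ?_ (B.comp_natural t _ _ c₂).symm
      exact CubicalSet.cube_comp_congr rfl (by simp only [Category.assoc]) _ _
    · rw [Category.assoc, h, Category.assoc]
    · rw [Category.assoc, h', ← Category.assoc, Subsingleton.elim (t ≫ _)]

/-- A point of each cube. -/
theorem exists_point (B : CubeCategory N) : ∃ p : N.N ⟶ B.Hom,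
    p ≫ B.dom = terminal.from _ ≫ N.zero ∧ p ≫ B.cod = 𝟙 N.N := by
  let g : B.Hom ⟶ B.Hom := B.comp (CubicalSet.bang B B.dom) (terminal.from _ ≫ B.end₀)
    (by rw [CubicalSet.bang_cod, Category.assoc, B.end₀_dom])
  have hg : 𝟙 B.Hom ≫ B.dom = g ≫ B.dom := by
    rw [B.comp_dom, CubicalSet.bang_dom, Category.id_comp]
  have hg' : g ≫ B.cod = terminal.from _ ≫ N.zero ≫ N.succ := by
    rw [B.comp_cod, Category.assoc, B.end₀_cod]
  -- Each step appends the coordinate `end₀` to a point of `[n]`. The recursion runs in all of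
  -- `B.Hom`; `hd` and `hc` then identify domain and codomain by uniqueness of recursion.
  obtain ⟨r, ⟨h₀, h₁⟩, -⟩ := N.exists_unique_rec (N.zero ≫ B.id) (B.pair (𝟙 _) g hg hg')
  have hl : terminal.from (⊤_ E) = 𝟙 _ := Subsingleton.elim _ _
  have hd := (N.exists_unique_rec N.zero (𝟙 N.N)).unique (y₁ := r ≫ B.dom)
    (y₂ := terminal.from _ ≫ N.zero)
    ⟨by rw [← Category.assoc, h₀, Category.assoc, B.id_dom, Category.comp_id],
      by rw [← Category.assoc, h₁, Category.assoc, pair_dom, Category.id_comp,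
        Category.comp_id]⟩
    ⟨by rw [← Category.assoc, Subsingleton.elim (_ ≫ terminal.from _) (𝟙 _), Category.id_comp],
      by rw [← Category.assoc, Subsingleton.elim (_ ≫ terminal.from _) (terminal.from _),
        Category.comp_id]⟩
  have hc := (N.exists_unique_rec N.zero N.succ).unique (y₁ := r ≫ B.cod) (y₂ := prod.snd)
    ⟨by rw [← Category.assoc, h₀, Category.assoc, B.id_cod, Category.comp_id],
      by rw [← Category.assoc, h₁, Category.assoc, pair_cod, Category.id_comp, Category.assoc]⟩
    ⟨by simp [hl], by simp⟩
  refine ⟨prod.lift (terminal.from _) (𝟙 _) ≫ r, ?_, ?_⟩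
  · rw [Category.assoc, hd, ← Category.assoc]
    congr 1; exact Subsingleton.elim _ _
  · rw [Category.assoc, hc, prod.lift_snd]

end CubeCategory

end Cubes

namespace CubicalSet

variable {E : Type u} [Category.{v} E] [HasFiniteLimits E] {N : NNO E} {B : CubeCategory N}

/-! ### Families of representables and the Yoneda lemma. -/

section Representable

variable {T : E}

/-- The `T`-indexed sum of the presheaves represented by `[n]`. -/
abbrev repr (B : CubeCategory N) (n : T ⟶ N.N) : CubicalSet B where
  carrier := pullback B.cod n
  dim := pullback.fst _ _ ≫ B.dom
  res {S} x φ h := pullback.lift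
    (B.comp φ (x ≫ pullback.fst _ _) (by rw [Category.assoc, h])) (x ≫ pullback.snd _ _) (by
      rw [B.comp_cod, Category.assoc, pullback.condition, ← Category.assoc])
  res_dim x φ h := by rw [pullback.lift_fst_assoc, B.comp_dom]
  res_natural t x φ h := by
    apply pullback.hom_ext
    · simp only [Category.assoc, pullback.lift_fst, B.comp_natural]
    · simp only [Category.assoc, pullback.lift_snd]
  res_id x := by
    apply pullback.hom_ext
    · rw [pullback.lift_fst]
      have := B.id_comp (x ≫ pullback.fst B.cod n)
      simpa only [Category.assoc] using this
    · rw [pullback.lift_snd]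
  res_comp x ψ φ h h' := by
    apply pullback.hom_ext
    · simp only [pullback.lift_fst]
      exact B.assoc _ _ _ _ _
    · simp only [pullback.lift_snd]

/-- The universal element of `repr B n`. -/
def gen (B : CubeCategory N) (n : T ⟶ N.N) : T ⟶ (repr B n).carrier :=
  pullback.lift (n ≫ B.id) (𝟙 T) (by rw [Category.assoc, B.id_cod, Category.comp_id,
    Category.id_comp])

theorem gen_dim (n : T ⟶ N.N) : gen B n ≫ (repr B n).dim = n := by
  simp [gen, B.id_dom]

/-- The map named by an element, by the Yoneda lemma. -/
def yon {X : CubicalSet B} {n : T ⟶ N.N} (z : T ⟶ X.carrier) (h : z ≫ X.dim = n) :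
    repr B n ⟶ X where
  map := X.res (pullback.snd B.cod n ≫ z) (pullback.fst B.cod n)
    (by rw [Category.assoc, h, pullback.condition])
  map_dim := X.res_dim _ _ _
  map_res {S} x φ e := by
    have h₀ : (x ≫ pullback.snd B.cod n ≫ z) ≫ X.dim = (x ≫ pullback.fst B.cod n) ≫ B.cod := by
      rw [Category.assoc, Category.assoc, Category.assoc, h, pullback.condition]
    have h₁ : φ ≫ B.cod = (x ≫ pullback.fst B.cod n) ≫ B.dom := by
      rw [Category.assoc]; exact e.symm
    rw [X.res_natural]
    refine (X.res_congr ?_ ?_ _ ?_).trans ((X.res_comp _ φ (x ≫ pullback.fst B.cod n) h₀ h₁).trans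
      (X.res_congr (X.res_natural _ _ _ _).symm rfl _ _))
    · rw [pullback.lift_snd_assoc, Category.assoc]
    · rw [pullback.lift_fst]
    · rw [B.comp_cod, h₀]

@[simp]
theorem gen_yon {X : CubicalSet B} {n : T ⟶ N.N} (z : T ⟶ X.carrier) (h : z ≫ X.dim = n) :
    gen B n ≫ (yon z h).map = z := by
  change gen B n ≫ X.res _ _ _ = z
  rw [X.res_natural]
  refine (X.res_congr ?_ ?_ _ ?_).trans (X.res_id z)
  · simp [gen]
  · simp [gen, ← h]
  · rw [Category.assoc, Category.assoc, B.id_cod, Category.comp_id]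

/-- Every element of the representable is a restriction of the generic one; `key` states this for
the universal element. -/
theorem repr_hom_ext {X : CubicalSet B} {n : T ⟶ N.N} {f g : repr B n ⟶ X}
    (h : gen B n ≫ f.map = gen B n ≫ g.map) : f = g := by
  have hd : (pullback.snd B.cod n ≫ gen B n) ≫ (repr B n).dim =
      pullback.fst B.cod n ≫ B.cod := by
    rw [Category.assoc, gen_dim, pullback.condition]
  have key : (repr B n).res (pullback.snd B.cod n ≫ gen B n) (pullback.fst B.cod n) hd =
      𝟙 _ := by
    apply pullback.hom_ext
    · rw [pullback.lift_fst, Category.id_comp]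
      refine (cube_comp_congr rfl ?_ _ ?_).trans (B.comp_id _)
      · rw [Category.assoc, gen, pullback.lift_fst, ← pullback.condition_assoc]
      · rw [Category.assoc, Category.assoc, B.id_dom, Category.comp_id]
    · rw [pullback.lift_snd, Category.id_comp, Category.assoc, gen, pullback.lift_snd,
        Category.comp_id]
  apply hom_ext
  rw [← Category.id_comp f.map, ← Category.id_comp g.map, ← key, f.map_res, g.map_res]
  exact X.res_congr (by rw [Category.assoc, Category.assoc, h]) rfl _ _

theorem yon_comp {X Y : CubicalSet B} {n : T ⟶ N.N} (z : T ⟶ X.carrier) (h : z ≫ X.dim = n)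
    (f : X ⟶ Y) : yon z h ≫ f = yon (z ≫ f.map) (by rw [Category.assoc, f.map_dim, h]) := by
  apply repr_hom_ext
  rw [comp_map, ← Category.assoc, gen_yon, gen_yon]

/-- Elements of cubical sets factor exactly when the maps they name do. -/
theorem fac_yon_iff {X Y : CubicalSet B} {n : T ⟶ N.N} (z : T ⟶ Y.carrier) (h : z ≫ Y.dim = n)
    (f : X ⟶ Y) : Fac (yon z h) f ↔ Fac z f.map := by
  constructor
  · rintro ⟨e, he⟩
    refine ⟨gen B n ≫ e.map, ?_⟩
    rw [Category.assoc, ← comp_map, he, gen_yon]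
  · rintro ⟨e, rfl⟩
    exact ⟨yon e (by rw [← h, Category.assoc, f.map_dim]), yon_comp _ _ _⟩

end Representable

/-- Elements of the carrier are maps out of representables, so cancellation transfers from cubical
sets to `E`. -/
instance mono_map {X Y : CubicalSet B} (f : X ⟶ Y) [Mono f] : Mono f.map := by
  refine ⟨fun {T} x y h => ?_⟩
  have hx : y ≫ X.dim = x ≫ X.dim := by
    rw [← f.map_dim, ← Category.assoc, ← h, Category.assoc]
  have : yon x rfl = yon y hx := by
    rw [← cancel_mono f, yon_comp, yon_comp]
    apply repr_hom_ext
    simp [h]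
  rw [← gen_yon x rfl, this, gen_yon]

theorem mono_of_mono_map {X Y : CubicalSet B} (f : X ⟶ Y) [Mono f.map] : Mono f :=
  ⟨fun g h e => hom_ext (by rw [← cancel_mono f.map, ← comp_map, e, comp_map])⟩

/-- Compatibility of a factorisation with dimension and restriction can be checked after the
monomorphism, where it is known. -/
theorem fac_iff_map {W X Y : CubicalSet B} (w : W ⟶ Y) (f : X ⟶ Y) [Mono f.map] :
    Fac w f ↔ Fac w.map f.map := by
  constructor
  · rintro ⟨e, rfl⟩
    exact ⟨e.map, rfl⟩
  · rintro ⟨e, he⟩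
    refine ⟨⟨e, ?_, ?_⟩, hom_ext he⟩
    · rw [← f.map_dim, ← Category.assoc, he, w.map_dim]
    · intro T x φ h
      have hd : (x ≫ e) ≫ X.dim = φ ≫ B.cod := by
        rw [← h, ← w.map_dim, ← he, ← f.map_dim]
        simp only [Category.assoc]
      refine (cancel_mono f.map).1 ((Category.assoc _ _ _).trans ?_)
      refine (congrArg (W.res x φ h ≫ ·) he).trans ?_
      rw [w.map_res]
      refine Eq.trans ?_ (f.map_res (x ≫ e) φ hd).symm
      exact Y.res_congr (by rw [Category.assoc, he]) rfl _ _

/-- A compatible pair of elements names a compatible pair of maps out of one representable, and the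
universal property applies to those. -/
theorem isPullback_map {P X Y Z : CubicalSet B} {fst : P ⟶ X} {snd : P ⟶ Y} {f : X ⟶ Z}
    {g : Y ⟶ Z} (h : IsPullback fst snd f g) : IsPullback fst.map snd.map f.map g.map := by
  have key : ∀ {T : E} (a : T ⟶ X.carrier) (b : T ⟶ Y.carrier), a ≫ f.map = b ≫ g.map →
      ∃ e : T ⟶ P.carrier, e ≫ fst.map = a ∧ e ≫ snd.map = b := by
    intro T a b hab
    have hd : b ≫ Y.dim = a ≫ X.dim := by
      rw [← f.map_dim, ← g.map_dim, ← Category.assoc, ← hab, Category.assoc]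
    have hw : yon a rfl ≫ f = yon b hd ≫ g := by
      apply repr_hom_ext
      rw [yon_comp, yon_comp, gen_yon, gen_yon, hab]
    refine ⟨gen B _ ≫ (h.lift _ _ hw).map, ?_, ?_⟩
    · rw [Category.assoc, ← comp_map, h.lift_fst, gen_yon]
    · rw [Category.assoc, ← comp_map, h.lift_snd, gen_yon]
  refine ⟨⟨congrArg Hom.map h.w⟩, ⟨PullbackCone.IsLimit.mk _
    (fun s => (key s.fst s.snd s.condition).choose)
    (fun s => (key s.fst s.snd s.condition).choose_spec.1)
    (fun s => (key s.fst s.snd s.condition).choose_spec.2) fun s k h₁ h₂ => ?_⟩⟩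
  set k' := (key s.fst s.snd s.condition).choose with hk'
  have h₁' : k' ≫ fst.map = s.fst := (key s.fst s.snd s.condition).choose_spec.1
  have h₂' : k' ≫ snd.map = s.snd := (key s.fst s.snd s.condition).choose_spec.2
  have hd : k' ≫ P.dim = k ≫ P.dim := by
    rw [← fst.map_dim, ← Category.assoc, h₁', ← Category.assoc, h₁]
  have : yon k rfl = yon k' hd := by
    apply h.hom_ext
    · apply repr_hom_ext
      rw [yon_comp, yon_comp, gen_yon, gen_yon, h₁, h₁']
    · apply repr_hom_ext
      rw [yon_comp, yon_comp, gen_yon, gen_yon, h₂, h₂']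
  rw [← gen_yon k rfl, this, gen_yon]

/-! ### Initial objects and coproducts of cubical sets, detected on carriers. -/

section Initial

variable [HasStrictInitialObjects E]

theorem isInit_of_carrier {S : CubicalSet B} (h : IsInit S.carrier) : IsInit S := by
  obtain ⟨h⟩ := h
  refine ⟨IsInitial.ofUniqueHom (fun X => ⟨h.to _, h.hom_ext _ _, fun {T} x φ _ => ?_⟩)
    fun X f => hom_ext (h.hom_ext _ _)⟩
  obtain ⟨hT⟩ := IsInit.of_hom x ⟨h⟩
  exact hT.hom_ext _ _

variable [HasInitial E]

theorem isInit_carrier_const : IsInit ((const B).obj (⊥_ E)).carrier :=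
  IsInit.of_hom (prod.fst : (⊥_ E) ⨯ N.N ⟶ _) ⟨initialIsInitial⟩

/-- An initial cubical set maps to `Δ 0`, whose carrier is empty; strictness in `E` does the rest.
-/
theorem isInit_iff_carrier {S : CubicalSet B} : IsInit S ↔ IsInit S.carrier := by
  refine ⟨fun ⟨h⟩ => ?_, isInit_of_carrier⟩
  exact IsInit.of_hom (h.to ((const B).obj (⊥_ E))).map isInit_carrier_const

instance : HasInitial (CubicalSet B) :=
  (isInit_of_carrier (isInit_carrier_const (B := B))).some.hasInitial

instance : HasStrictInitialObjects (CubicalSet B) := by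
  refine ⟨fun {I A} f hI => ?_⟩
  obtain ⟨hA⟩ := isInit_iff_carrier.2 (IsInit.of_hom f.map (isInit_iff_carrier.1 ⟨hI⟩))
  exact ⟨hI.to A, hA.hom_ext _ _, hI.hom_ext _ _⟩

end Initial

section Coproducts

variable [FinitaryExtensive E]

/-- Coproducts of carriers are coproducts of cubical sets. -/
theorem isColimit_of_carrier {X Y S : CubicalSet B} (i : X ⟶ S) (j : Y ⟶ S)
    (h : Nonempty (IsColimit (BinaryCofan.mk i.map j.map))) :
    Nonempty (IsColimit (BinaryCofan.mk i j)) := by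
  have hext : ∀ {T V : E} (x : T ⟶ S.carrier) (a b : T ⟶ V),
      (∀ {T' : E} (t : T' ⟶ T) (y : T' ⟶ X.carrier), t ≫ x = y ≫ i.map → t ≫ a = t ≫ b) →
      (∀ {T' : E} (t : T' ⟶ T) (y : T' ⟶ Y.carrier), t ≫ x = y ≫ j.map → t ≫ a = t ≫ b) →
      a = b := by
    intro T V x a b h₁ h₂
    -- By extensivity the stage `T` splits into the parts where `x` lies in `X` and in `Y`, so
    -- equality may be checked on each part.
    obtain ⟨hT⟩ := isColimit_of_isPullback h (IsPullback.of_hasPullback x i.map)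
      (IsPullback.of_hasPullback x j.map)
    exact BinaryCofan.IsColimit.hom_ext hT (h₁ _ _ pullback.condition) (h₂ _ _ pullback.condition)
  obtain ⟨h⟩ := h
  have key : ∀ {V : CubicalSet B} (f : X ⟶ V) (g : Y ⟶ V),
      ∃ d : S ⟶ V, i ≫ d = f ∧ j ≫ d = g := by
    intro V f g
    obtain ⟨d, hd₁, hd₂⟩ : ∃ d : S.carrier ⟶ V.carrier, i.map ≫ d = f.map ∧ j.map ≫ d = g.map :=
      ⟨_, (BinaryCofan.IsColimit.desc' h f.map g.map).2⟩
    have hdim : d ≫ V.dim = S.dim := by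
      refine BinaryCofan.IsColimit.hom_ext h ?_ ?_
      · change i.map ≫ _ = i.map ≫ _
        rw [← Category.assoc, hd₁, f.map_dim, i.map_dim]
      · change j.map ≫ _ = j.map ≫ _
        rw [← Category.assoc, hd₂, g.map_dim, j.map_dim]
    refine ⟨⟨d, hdim, fun {T} x φ e => ?_⟩, hom_ext hd₁, hom_ext hd₂⟩
    refine hext x _ _ (fun {T'} t y hy => ?_) (fun {T'} t y hy => ?_)
    · have hyd : y ≫ X.dim = (t ≫ φ) ≫ B.cod := by
        rw [← i.map_dim, ← Category.assoc, ← hy, Category.assoc, e, Category.assoc]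
      rw [← Category.assoc, S.res_natural, V.res_natural]
      have e₁ : S.res (t ≫ x) (t ≫ φ) (by simp only [Category.assoc, e]) =
          X.res y (t ≫ φ) hyd ≫ i.map := by
        rw [i.map_res]
        exact S.res_congr hy rfl _ _
      rw [e₁, Category.assoc, hd₁, f.map_res]
      exact V.res_congr (by rw [← Category.assoc, hy, Category.assoc, hd₁]) rfl _ _
    · have hyd : y ≫ Y.dim = (t ≫ φ) ≫ B.cod := by
        rw [← j.map_dim, ← Category.assoc, ← hy, Category.assoc, e, Category.assoc]
      rw [← Category.assoc, S.res_natural, V.res_natural]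
      have e₁ : S.res (t ≫ x) (t ≫ φ) (by simp only [Category.assoc, e]) =
          Y.res y (t ≫ φ) hyd ≫ j.map := by
        rw [j.map_res]
        exact S.res_congr hy rfl _ _
      rw [e₁, Category.assoc, hd₂, g.map_res]
      exact V.res_congr (by rw [← Category.assoc, hy, Category.assoc, hd₂]) rfl _ _
  refine ⟨BinaryCofan.IsColimit.mk _ (fun f g => (key f g).choose)
    (fun f g => (key f g).choose_spec.1) (fun f g => (key f g).choose_spec.2)
    fun f g d h₁ h₂ => hom_ext (BinaryCofan.IsColimit.hom_ext h ?_ ?_)⟩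
  · exact congrArg Hom.map (h₁.trans (key f g).choose_spec.1.symm)
  · exact congrArg Hom.map (h₂.trans (key f g).choose_spec.2.symm)

end Coproducts

end CubicalSet

namespace CubicalSet

variable {E : Type u} [Category.{v} E] [HasFiniteLimits E] {N : NNO E} {B : CubeCategory N}

/-! ### The cylinder on `[n]` and the cube `[n + 1]`. -/

section Cylinder

variable {T : E}

theorem precomp_terminal {S T X : E} (t : S ⟶ T) (x : ⊤_ E ⟶ X) :
    t ≫ terminal.from T ≫ x = terminal.from S ≫ x := by
  rw [← Category.assoc]
  congr 1; exact Subsingleton.elim _ _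

theorem bang_unique {f g : T ⟶ B.Hom} (h : f ≫ B.dom = g ≫ B.dom)
    (hf : f ≫ B.cod = terminal.from T ≫ N.zero) (hg : g ≫ B.cod = terminal.from T ≫ N.zero) :
    f = g := by
  rw [bang_eq f hf, bang_eq g hg, h]

theorem precomp_bang {S : E} (t : S ⟶ T) (n : T ⟶ N.N) : t ≫ bang B n = bang B (t ≫ n) := by
  apply bang_unique
  · rw [Category.assoc, bang_dom, bang_dom]
  · rw [Category.assoc, bang_cod, precomp_terminal]
  · rw [bang_cod]

/-- The index of a cube of `repr B n`. -/
def reprProj (B : CubeCategory N) (n : T ⟶ N.N) : repr B n ⟶ (const B).obj T where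
  map := prod.lift (pullback.snd _ _) (pullback.fst _ _ ≫ B.dom)
  map_dim := prod.lift_snd _ _
  map_res {S} x φ h := by
    change pullback.lift _ _ _ ≫ _ = prod.lift _ _
    apply Limits.prod.hom_ext
    · simp
    · simp [B.comp_dom]

/-- The family of points of the interval given by a family of maps `[0] ⟶ [1]`. -/
def pointMap (r : T ⟶ B.Hom) (h₀ : r ≫ B.dom = terminal.from T ≫ N.zero)
    (h₁ : r ≫ B.cod = terminal.from T ≫ N.zero ≫ N.succ) :
    (const B).obj T ⟶ interval B where
  map := pullback.lift
    (B.comp (bang B prod.snd) (prod.fst ≫ r)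
      (by rw [bang_cod, Category.assoc, h₀, precomp_terminal]))
    (terminal.from _) (by rw [B.comp_cod, Category.assoc, h₁, precomp_terminal])
  map_dim := by
    change _ ≫ pullback.fst _ _ ≫ B.dom = _
    rw [pullback.lift_fst_assoc, B.comp_dom, bang_dom]
  map_res {S} x φ h := by
    have e₀ : (bang B (prod.snd : T ⨯ N.N ⟶ _)) ≫ B.cod = (prod.fst ≫ r) ≫ B.dom := by
      rw [bang_cod, Category.assoc, h₀, precomp_terminal]
    have key : ∀ {S : E} (y : S ⟶ T ⨯ N.N) (w), (y ≫ pullback.lift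
        (B.comp (bang B prod.snd) (prod.fst ≫ r) e₀) (terminal.from _) w) ≫
          pullback.fst B.cod (N.zero ≫ N.succ) =
        B.comp (bang B (y ≫ prod.snd)) ((y ≫ prod.fst) ≫ r)
          (by simp only [bang_cod, Category.assoc, h₀, precomp_terminal]) := by
      intro S y w
      rw [Category.assoc, pullback.lift_fst, B.comp_natural]
      exact cube_comp_congr (precomp_bang _ _) (Category.assoc _ _ _).symm _ _
    apply pullback.hom_ext
    · have e₁ : φ ≫ B.cod = bang B (x ≫ prod.snd) ≫ B.dom := by rw [bang_dom]; exact h.symm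
      have e₂ : bang B (x ≫ prod.snd) ≫ B.cod = ((x ≫ prod.fst) ≫ r) ≫ B.dom := by
        simp only [bang_cod, Category.assoc, h₀, precomp_terminal]
      refine (key _ _).trans (Eq.trans ?_ (pullback.lift_fst _ _ _).symm)
      refine Eq.trans ?_ ((B.assoc φ _ _ e₁ e₂).trans (cube_comp_congr rfl (key _ _).symm _ _))
      refine cube_comp_congr ?_ ?_ _ _
      · apply bang_unique
        · rw [bang_dom, B.comp_dom]
          exact prod.lift_snd _ _
        · rw [bang_cod]
        · rw [B.comp_cod, bang_cod]
      · change (prod.lift _ _ ≫ prod.fst) ≫ r = _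
        rw [prod.lift_fst]
    · exact Subsingleton.elim _ _

theorem lift_map_fst {X Y W : CubicalSet B} (a : W ⟶ X) (b : W ⟶ Y) :
    (prod.lift a b).map ≫ (prod.fst : X ⨯ Y ⟶ X).map = a.map := by
  rw [← comp_map, prod.lift_fst]

theorem lift_map_snd {X Y W : CubicalSet B} (a : W ⟶ X) (b : W ⟶ Y) :
    (prod.lift a b).map ≫ (prod.snd : X ⨯ Y ⟶ Y).map = b.map := by
  rw [← comp_map, prod.lift_snd]

theorem cylinder_dom (n : T ⟶ N.N) :
    ((prod.snd : interval B ⨯ repr B n ⟶ _).map ≫ pullback.fst _ _) ≫ B.dom =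
      ((prod.fst : interval B ⨯ repr B n ⟶ _).map ≫ pullback.fst _ _) ≫ B.dom := by
  have h₁ := (prod.fst : interval B ⨯ repr B n ⟶ _).map_dim
  have h₂ := (prod.snd : interval B ⨯ repr B n ⟶ _).map_dim
  rw [Category.assoc, Category.assoc]
  exact h₂.trans h₁.symm

theorem interval_cod {S : E} (x : S ⟶ (interval B).carrier) :
    (x ≫ pullback.fst _ _) ≫ B.cod = terminal.from S ≫ N.zero ≫ N.succ := by
  rw [Category.assoc, pullback.condition, ← Category.assoc]
  congr 1; exact Subsingleton.elim _ _

/-- `[k] ⟶ [1]` and `[k] ⟶ [n]` form a pair `[k] ⟶ [n + 1]`. -/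
def cylinder (B : CubeCategory N) (n : T ⟶ N.N) : interval B ⨯ repr B n ⟶ repr B (n ≫ N.succ) where
  map := pullback.lift
    (B.pair ((prod.snd : interval B ⨯ repr B n ⟶ _).map ≫ pullback.fst _ _)
      ((prod.fst : interval B ⨯ repr B n ⟶ _).map ≫ pullback.fst _ _) (cylinder_dom n)
      (interval_cod _))
    ((prod.snd : interval B ⨯ repr B n ⟶ _).map ≫ pullback.snd _ _)
    (by rw [CubeCategory.pair_cod, Category.assoc, pullback.condition_assoc, Category.assoc])
  map_dim := by
    change _ ≫ pullback.fst _ _ ≫ B.dom = _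
    rw [pullback.lift_fst_assoc, CubeCategory.pair_dom, Category.assoc]
    exact (prod.snd : interval B ⨯ repr B n ⟶ _).map_dim
  map_res {S} x φ h := by
    have e : φ ≫ B.cod =
        (x ≫ (prod.snd : interval B ⨯ repr B n ⟶ _).map ≫ pullback.fst _ _) ≫ B.dom := by
      rw [← h, Category.assoc, Category.assoc]
      exact congrArg (x ≫ ·) (prod.snd : interval B ⨯ repr B n ⟶ _).map_dim.symm
    apply pullback.hom_ext
    · refine Eq.trans ?_ (pullback.lift_fst _ _ _).symm
      rw [Category.assoc, pullback.lift_fst, CubeCategory.precomp_pair]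
      refine Eq.trans ?_ (Eq.trans (CubeCategory.comp_pair (φ := φ)
        (f := x ≫ (prod.snd : interval B ⨯ repr B n ⟶ _).map ≫ pullback.fst _ _)
        (g := x ≫ (prod.fst : interval B ⨯ repr B n ⟶ _).map ≫ pullback.fst _ _)
        ?_ ?_ e).symm (cube_comp_congr rfl ?_ _ _))
      · apply CubeCategory.pair_congr
        · rw [← Category.assoc, Hom.map_res]
          refine (pullback.lift_fst _ _ _).trans ?_
          exact cube_comp_congr rfl (Category.assoc _ _ _) _ _
        · rw [← Category.assoc, Hom.map_res]
          refine (pullback.lift_fst _ _ _).trans ?_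
          exact cube_comp_congr rfl (Category.assoc _ _ _) _ _
      · rw [Category.assoc, cylinder_dom, ← Category.assoc]
      · rw [← Category.assoc, interval_cod]
      · exact (CubeCategory.precomp_pair x _ _).symm.trans
          ((congrArg (x ≫ ·) (pullback.lift_fst _ _ _).symm).trans (Category.assoc _ _ _).symm)
    · refine Eq.trans ?_ (pullback.lift_snd _ _ _).symm
      refine (Category.assoc _ _ _).trans ((congrArg (_ ≫ ·) (pullback.lift_snd _ _ _)).trans ?_)
      refine Eq.trans ?_ ((congrArg (x ≫ ·) (pullback.lift_snd _ _ _).symm).trans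
        (Category.assoc _ _ _).symm)
      dsimp only
      rw [← Category.assoc, Hom.map_res]
      refine (pullback.lift_snd _ _ _).trans ?_
      rw [Category.assoc]

/-- The face `[n] ⟶ [n + 1]` at the point `r` of the last coordinate. -/
def face (n : T ⟶ N.N) (r : T ⟶ B.Hom) (h₀ : r ≫ B.dom = terminal.from T ≫ N.zero)
    (h₁ : r ≫ B.cod = terminal.from T ≫ N.zero ≫ N.succ) : T ⟶ B.Hom :=
  B.pair (n ≫ B.id) (B.comp (bang B n) r (by rw [bang_cod, h₀]))
    (by rw [B.comp_dom, bang_dom, Category.assoc, B.id_dom, Category.comp_id])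
    (by rw [B.comp_cod, h₁])

section

variable (n : T ⟶ N.N) (r : T ⟶ B.Hom) (h₀ : r ≫ B.dom = terminal.from T ≫ N.zero)
    (h₁ : r ≫ B.cod = terminal.from T ≫ N.zero ≫ N.succ)

theorem face_dom : face n r h₀ h₁ ≫ B.dom = n := by
  rw [face, CubeCategory.pair_dom, Category.assoc, B.id_dom, Category.comp_id]

theorem face_cod : face n r h₀ h₁ ≫ B.cod = n ≫ N.succ := by
  rw [face, CubeCategory.pair_cod, Category.assoc, ← Category.assoc B.id, B.id_cod,
    Category.id_comp]

/-- Identifies the inclusion at a point of the interval with restriction along a face, so that a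
lifting problem for cylinders becomes a statement about restrictions of cubes. -/
theorem lift_point_cylinder :
    prod.lift (reprProj B n ≫ pointMap r h₀ h₁) (𝟙 _) ≫ cylinder B n =
      yon ((repr B (n ≫ N.succ)).res (gen B (n ≫ N.succ)) (face n r h₀ h₁)
        (by rw [gen_dim, face_cod])) (by rw [(repr B (n ≫ N.succ)).res_dim, face_dom]) := by
  apply repr_hom_ext
  rw [gen_yon]
  have e₁ : gen B n ≫ (prod.lift (reprProj B n ≫ pointMap r h₀ h₁) (𝟙 _)).map ≫
      (prod.snd : interval B ⨯ repr B n ⟶ _).map = gen B n := by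
    rw [lift_map_snd]
    exact Category.comp_id _
  have e₂ : gen B n ≫ (prod.lift (reprProj B n ≫ pointMap r h₀ h₁) (𝟙 _)).map ≫
      (prod.fst : interval B ⨯ repr B n ⟶ _).map =
      prod.lift (𝟙 T) n ≫ (pointMap r h₀ h₁).map := by
    rw [lift_map_fst, comp_map, ← Category.assoc]
    congr 1
    change gen B n ≫ prod.lift _ _ = _
    apply Limits.prod.hom_ext <;> simp [gen, B.id_dom]
  apply pullback.hom_ext
  · refine Eq.trans ?_ (pullback.lift_fst _ _ _).symm
    rw [comp_map]
    refine (Category.assoc _ _ _).trans ?_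
    refine (congrArg (gen B n ≫ ·) (Category.assoc _ _ _)).trans ?_
    have e₃ : (cylinder B n).map ≫ pullback.fst B.cod (n ≫ N.succ) =
      B.pair ((prod.snd : interval B ⨯ repr B n ⟶ _).map ≫ pullback.fst _ _)
      ((prod.fst : interval B ⨯ repr B n ⟶ _).map ≫ pullback.fst _ _) (cylinder_dom n)
      (interval_cod _) := pullback.lift_fst _ _ _
    dsimp only
    rw [e₃, CubeCategory.precomp_pair, CubeCategory.precomp_pair]
    refine Eq.trans ?_ ((B.comp_id _).symm.trans (cube_comp_congr rfl ?_ _ ?_))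
    · rw [face]
      apply CubeCategory.pair_congr
      · rw [← Category.assoc, ← Category.assoc, Category.assoc (gen B n), e₁]
        exact pullback.lift_fst _ _ _
      · rw [← Category.assoc, ← Category.assoc, Category.assoc (gen B n), e₂]
        change (_ ≫ pullback.lift _ _ _) ≫ _ = _
        rw [Category.assoc, pullback.lift_fst, B.comp_natural]
        refine cube_comp_congr ?_ ?_ _ _
        · rw [precomp_bang, prod.lift_snd]
        · rw [prod.lift_fst_assoc, Category.id_comp]
    · rw [← Category.assoc, face_cod]
      exact (pullback.lift_fst _ _ _).symm
    · exact (face_cod n r h₀ h₁).trans ((gen_dim (B := B) (n ≫ N.succ)).symm.trans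
        (Category.assoc _ _ _).symm)
  · refine Eq.trans ?_ (pullback.lift_snd _ _ _).symm
    rw [comp_map]
    refine (Category.assoc _ _ _).trans ?_
    refine (congrArg (gen B n ≫ ·) (Category.assoc _ _ _)).trans ?_
    have e₃ : (cylinder B n).map ≫ pullback.snd B.cod (n ≫ N.succ) =
      (prod.snd : interval B ⨯ repr B n ⟶ _).map ≫ pullback.snd _ _ := pullback.lift_snd _ _ _
    dsimp only
    rw [e₃, ← Category.assoc, ← Category.assoc, Category.assoc (gen B n), e₁]
    exact (pullback.lift_snd _ _ _).trans (pullback.lift_snd _ _ _).symm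

/-- The section has the two projections of `[n + 1]` as components. Exhibiting the cube as a retract
of the cylinder is enough to transport lifts. -/
theorem exists_section_cylinder :
    ∃ s : repr B (n ≫ N.succ) ⟶ interval B ⨯ repr B n, s ≫ cylinder B n = 𝟙 _ := by
  let a : T ⟶ (interval B).carrier := pullback.lift (n ≫ B.snd) (terminal.from T)
    (by rw [Category.assoc, B.snd_cod, precomp_terminal])
  let b : T ⟶ (repr B n).carrier := pullback.lift (n ≫ B.fst) (𝟙 T)
    (by rw [Category.assoc, B.fst_cod, Category.comp_id, Category.id_comp])
  have ha : a ≫ (interval B).dim = n ≫ N.succ := by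
    simp [a, B.snd_dom]
  have hb : b ≫ (repr B n).dim = n ≫ N.succ := by
    simp [b, B.fst_dom]
  refine ⟨prod.lift (yon a ha) (yon b hb), repr_hom_ext ?_⟩
  have e₁ : gen B (n ≫ N.succ) ≫ (prod.lift (yon a ha) (yon b hb)).map ≫
      (prod.snd : interval B ⨯ repr B n ⟶ _).map = b := by
    rw [lift_map_snd, gen_yon]
  have e₂ : gen B (n ≫ N.succ) ≫ (prod.lift (yon a ha) (yon b hb)).map ≫
      (prod.fst : interval B ⨯ repr B n ⟶ _).map = a := by
    rw [lift_map_fst, gen_yon]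
  rw [comp_map]
  refine Eq.trans ?_ (Category.comp_id _).symm
  apply pullback.hom_ext
  · rw [Category.assoc, Category.assoc]
    have e₃ : (cylinder B n).map ≫ pullback.fst B.cod (n ≫ N.succ) =
      B.pair ((prod.snd : interval B ⨯ repr B n ⟶ _).map ≫ pullback.fst _ _)
      ((prod.fst : interval B ⨯ repr B n ⟶ _).map ≫ pullback.fst _ _) (cylinder_dom n)
      (interval_cod _) := pullback.lift_fst _ _ _
    rw [e₃, CubeCategory.precomp_pair, CubeCategory.precomp_pair, gen, pullback.lift_fst]
    have hf : gen B (n ≫ N.succ) ≫ (prod.lift (yon a ha) (yon b hb)).map ≫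
      (prod.snd : interval B ⨯ repr B n ⟶ _).map ≫ pullback.fst _ _ = n ≫ B.fst := by
      rw [← Category.assoc, ← Category.assoc, Category.assoc (gen B _), e₁, pullback.lift_fst]
    have hg : gen B (n ≫ N.succ) ≫ (prod.lift (yon a ha) (yon b hb)).map ≫
      (prod.fst : interval B ⨯ repr B n ⟶ _).map ≫ pullback.fst _ _ = n ≫ B.snd := by
      rw [← Category.assoc, ← Category.assoc, Category.assoc (gen B _), e₂, pullback.lift_fst]
    have hd : (n ≫ B.fst) ≫ B.dom = (n ≫ B.snd) ≫ B.dom := by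
      rw [Category.assoc, Category.assoc, B.fst_dom, B.snd_dom]
    have hc : (n ≫ B.snd) ≫ B.cod = terminal.from T ≫ N.zero ≫ N.succ := by
      rw [Category.assoc, B.snd_cod, precomp_terminal]
    have hn : (n ≫ B.fst) ≫ B.cod = n := by rw [Category.assoc, B.fst_cod, Category.comp_id]
    refine (CubeCategory.pair_congr hf hg _ _ hd hc).trans ?_
    refine CubeCategory.pair_ext (n := n) ?_ ?_ ?_ ?_
    · rw [CubeCategory.pair_cod, ← Category.assoc, hn]
    · rw [Category.assoc, Category.assoc, B.id_cod, Category.comp_id]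
    · refine (cube_comp_congr rfl ?_ _ ?_).trans ((CubeCategory.comp_pair_fst hd hc).trans
        ((B.id_comp (n ≫ B.fst)).symm.trans (cube_comp_congr ?_ rfl _ _)))
      · rw [← Category.assoc (n ≫ B.fst), hn]
      · rw [CubeCategory.pair_cod]; simp only [Category.assoc, B.fst_dom]
      · rw [Category.assoc, ← Category.assoc B.fst, B.fst_dom, Category.assoc]
    · refine (cube_comp_congr rfl ?_ _ ?_).trans ((CubeCategory.comp_pair_snd hd hc).trans
        ((B.id_comp (n ≫ B.snd)).symm.trans (cube_comp_congr ?_ rfl _ _)))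
      · rw [← Category.assoc (n ≫ B.fst), hn]
      · rw [CubeCategory.pair_cod]; simp only [Category.assoc, B.snd_dom]
      · rw [Category.assoc, ← Category.assoc B.snd, B.snd_dom, Category.assoc]
  · rw [Category.assoc, Category.assoc]
    have e₃ : (cylinder B n).map ≫ pullback.snd B.cod (n ≫ N.succ) =
      (prod.snd : interval B ⨯ repr B n ⟶ _).map ≫ pullback.snd _ _ := pullback.lift_snd _ _ _
    rw [e₃, ← Category.assoc, ← Category.assoc, Category.assoc (gen B _), e₁]
    exact (pullback.lift_snd _ _ _).trans (pullback.lift_snd _ _ _).symm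

end

end Cylinder

/-! ### Monic fibrations are invariant under restriction of cubes. -/

section Invariance

variable {Fib : MorphismProperty (CubicalSet B)} (hF : IsKanFibrationClass Fib)
include hF

/-- The element of `U` over the face is a partial lift of the cylinder on `z`. The lifting property
extends it, and the section of the cylinder brings it back to `z`. The families in `hurewicz` are
needed because `n` and `r` are generalised elements. -/
theorem IsKanFibrationClass.fac_of_face {T : E} (n : T ⟶ N.N) (r : T ⟶ B.Hom)
    (h₀ : r ≫ B.dom = terminal.from T ≫ N.zero)
    (h₁ : r ≫ B.cod = terminal.from T ≫ N.zero ≫ N.succ) {U Z : CubicalSet B} (u : U ⟶ Z)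
    (hu : Fib u) (z : T ⟶ Z.carrier) (hz : z ≫ Z.dim = n ≫ N.succ)
    (H : Fac (Z.res z (face n r h₀ h₁) (by rw [hz, face_cod])) u.map) : Fac z u.map := by
  have hd : Z.res z (face n r h₀ h₁) (by rw [hz, face_cod]) ≫ Z.dim = n := by
    rw [Z.res_dim, face_dom]
  rw [← fac_yon_iff _ hd] at H
  rw [← fac_yon_iff _ hz]
  obtain ⟨e, he⟩ := H
  obtain ⟨s, hs⟩ := exists_section_cylinder (B := B) n
  have := hF.hurewicz (reprProj B n) (pointMap r h₀ h₁) u hu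
  have sq : CommSq e (prod.lift (reprProj B n ≫ pointMap r h₀ h₁) (𝟙 _)) u
      (cylinder B n ≫ yon z hz) := by
    refine ⟨?_⟩
    rw [he, ← Category.assoc, lift_point_cylinder, yon_comp]
    apply repr_hom_ext
    rw [gen_yon, gen_yon, Hom.map_res]
    exact Z.res_congr (gen_yon _ _).symm rfl _ _
  exact ⟨s ≫ sq.lift, by rw [Category.assoc, sq.fac_right, ← Category.assoc, hs,
    Category.id_comp]⟩

/-- Induction on the dimension, removing the last coordinate of the point by `fac_of_face`. The
induction is internal to `E`, so its hypothesis has to be made a subobject of `N`; this is where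
monicity of `u.map` enters. -/
theorem IsKanFibrationClass.fac_of_point (hE : LocallyCartesianClosed E) {U Z : CubicalSet B}
    (u : U ⟶ Z) (hu : Fib u) [Mono u.map] {T : E} (z : T ⟶ Z.carrier) (p : T ⟶ B.Hom)
    (hp : p ≫ B.dom = terminal.from T ≫ N.zero) (h : z ≫ Z.dim = p ≫ B.cod)
    (H : Fac (Z.res z p h) u.map) : Fac z u.map := by
  -- Pairs of a cube of `Z` and an arrow into its dimension; `pullback q N.zero` keeps those whose
  -- arrow is a point, and `zA` below is the cube of such a pair whose restriction lies in `U`.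
  let q : pullback Z.dim B.cod ⟶ N.N := pullback.snd _ _ ≫ B.dom
  let z₂ : pullback q N.zero ⟶ Z.carrier := pullback.fst _ _ ≫ pullback.fst _ _
  let p₂ : pullback q N.zero ⟶ B.Hom := pullback.fst _ _ ≫ pullback.snd _ _
  have h₂ : z₂ ≫ Z.dim = p₂ ≫ B.cod := by
    simp only [z₂, p₂, Category.assoc, pullback.condition]
  have hp₂ : p₂ ≫ B.dom = terminal.from _ ≫ N.zero := by
    simp only [p₂, Category.assoc]
    refine pullback.condition.trans ?_
    congr 1; exact Subsingleton.elim _ _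
  let zA : pullback (Z.res z₂ p₂ h₂) u.map ⟶ Z.carrier := pullback.fst _ _ ≫ z₂
  -- `S` consists of the dimensions for which every such pair has its cube in `U`; `hS` spells this
  -- out at generalised elements.
  obtain ⟨S, i, hi⟩ := hE.exists_depProd (pullback.snd u.map zA) (zA ≫ Z.dim)
  have : Mono i := hi.mono
  have hS : ∀ {W : E} (w : W ⟶ N.N), Fac w i ↔ ∀ ⦃V : E⦄ (s : V ⟶ W) (z : V ⟶ Z.carrier)
      (p : V ⟶ B.Hom) (_ : p ≫ B.dom = terminal.from V ≫ N.zero) (h : z ≫ Z.dim = p ≫ B.cod),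
      s ≫ w = z ≫ Z.dim → Fac (Z.res z p h) u.map → Fac z u.map := by
    intro W w
    rw [hi.fac_iff]
    simp only [fac_snd_iff]
    constructor
    · rintro H V s z p hp h hs ⟨e, he⟩
      let a : V ⟶ pullback q N.zero := pullback.lift (pullback.lift z p h) (terminal.from V)
        (by simp only [q, pullback.lift_snd_assoc, hp])
      have ha : a ≫ Z.res z₂ p₂ h₂ = Z.res z p h := by
        rw [Z.res_natural]
        exact Z.res_congr (by simp [a, z₂]) (by simp [a, p₂]) _ _
      let y : V ⟶ pullback (Z.res z₂ p₂ h₂) u.map := pullback.lift a e (by rw [ha, he])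
      have hy : y ≫ zA = z := by simp [y, zA, a, z₂]
      have := H s y (by rw [← Category.assoc, hy, hs])
      rwa [hy] at this
    · intro H V s y hy
      refine H s (y ≫ zA) (y ≫ pullback.fst _ _ ≫ p₂) ?_ ?_ ?_ ?_
      · simp only [Category.assoc, hp₂, precomp_terminal]
      · simp only [zA, Category.assoc]; rw [h₂]
      · exact hy.trans (Category.assoc _ _ _).symm
      · refine ⟨y ≫ pullback.snd _ _, ?_⟩
        rw [Category.assoc, ← pullback.condition, ← Category.assoc, Z.res_natural]
        exact Z.res_congr (by simp [zA]) (by simp) _ _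
  have hid : Fac (𝟙 N.N) i := by
    refine N.fac_id_of_mono i ((hS _).2 ?_) ((hS _).2 ?_)
    · intro V s z p hp h hs H
      have hc : p ≫ B.cod = terminal.from V ≫ N.zero := by
        rw [← h, ← hs]
        congr 1; exact Subsingleton.elim _ _
      -- In dimension zero the point is the identity of the terminal object `[0]`, so restriction
      -- along it changes nothing.
      have hpid : p = z ≫ Z.dim ≫ B.id := by
        apply bang_unique _ hc
        · rw [Category.assoc, Category.assoc, B.id_cod, Category.comp_id, h, hc]
        · rw [Category.assoc, Category.assoc, B.id_dom, Category.comp_id, h, hc, hp]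
      have hr := Z.res_id z
      rwa [Z.res_congr rfl hpid h (by rw [← hpid, h]), hr] at H
    · intro V s z p hp h hs H
      have IH := (hS i).1 (Fac.refl i)
      have hz : z ≫ Z.dim = (s ≫ i) ≫ N.succ := by rw [← hs, Category.assoc]
      have e₁ : p ≫ B.cod = ((s ≫ i) ≫ B.fst) ≫ B.dom := by
        rw [← h, hz, Category.assoc _ B.fst, B.fst_dom]
      have e₂ : p ≫ B.cod = ((s ≫ i) ≫ B.snd) ≫ B.dom := by
        rw [← h, hz, Category.assoc _ B.snd, B.snd_dom]
      have hr₀ : B.comp p ((s ≫ i) ≫ B.snd) e₂ ≫ B.dom = terminal.from V ≫ N.zero := by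
        rw [B.comp_dom, hp]
      have hr₁ : B.comp p ((s ≫ i) ≫ B.snd) e₂ ≫ B.cod =
          terminal.from V ≫ N.zero ≫ N.succ := by
        rw [B.comp_cod, Category.assoc, B.snd_cod, precomp_terminal]
      have hp₀ : B.comp p ((s ≫ i) ≫ B.fst) e₁ ≫ B.dom = terminal.from V ≫ N.zero := by
        rw [B.comp_dom, hp]
      have hp₁ : B.comp p ((s ≫ i) ≫ B.fst) e₁ ≫ B.cod = s ≫ i := by
        rw [B.comp_cod, Category.assoc, B.fst_cod, Category.comp_id]
      have hc : B.comp p ((s ≫ i) ≫ B.fst) e₁ ≫ B.cod = face (s ≫ i) _ hr₀ hr₁ ≫ B.dom := by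
        rw [hp₁, face_dom]
      -- A point of `[n + 1]` is its projection to `[n]` followed by the face at its last
      -- coordinate.
      have hpf : B.comp (B.comp p ((s ≫ i) ≫ B.fst) e₁) (face (s ≫ i) _ hr₀ hr₁) hc = p := by
        have hx : B.comp p ((s ≫ i) ≫ B.fst) e₁ ≫ B.cod = ((s ≫ i) ≫ B.id) ≫ B.dom := by
          rw [hp₁, Category.assoc _ B.id, B.id_dom, Category.comp_id]
        have hb : B.comp p ((s ≫ i) ≫ B.fst) e₁ ≫ B.cod = bang B (s ≫ i) ≫ B.dom := by
          rw [hp₁, bang_dom]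
        have hbr : bang B (s ≫ i) ≫ B.cod = B.comp p ((s ≫ i) ≫ B.snd) e₂ ≫ B.dom := by
          rw [bang_cod, hr₀]
        have hbb : B.comp (B.comp p ((s ≫ i) ≫ B.fst) e₁) (bang B (s ≫ i)) hb =
            B.comp p ((s ≫ i) ≫ B.snd) e₂ ≫ B.dom ≫ B.id := by
          apply bang_unique
          · rw [B.comp_dom, B.comp_dom]
            simp only [Category.assoc, B.id_dom, Category.comp_id]
            rw [B.comp_dom]
          · rw [B.comp_cod, bang_cod]
          · refine (Category.assoc _ _ _).trans ((congrArg (_ ≫ ·) ?_).trans hr₀)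
            rw [Category.assoc, B.id_cod, Category.comp_id]
        have i₁ : B.comp (B.comp p ((s ≫ i) ≫ B.fst) e₁) ((s ≫ i) ≫ B.id) hx =
            B.comp p ((s ≫ i) ≫ B.fst) e₁ := by
          refine (cube_comp_congr rfl ?_ _ ?_).trans (B.comp_id _)
          · rw [← Category.assoc (B.comp _ _ _), hp₁]
          · simp only [Category.assoc, B.id_dom, Category.comp_id]
        have i₂ : B.comp (B.comp p ((s ≫ i) ≫ B.fst) e₁)
            (B.comp (bang B (s ≫ i)) (B.comp p ((s ≫ i) ≫ B.snd) e₂) hbr)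
            (by rw [B.comp_dom, hb]) = B.comp p ((s ≫ i) ≫ B.snd) e₂ := by
          rw [← B.assoc _ _ _ hb hbr]
          refine (cube_comp_congr hbb rfl _ ?_).trans (B.id_comp _)
          simp only [Category.assoc, B.id_cod, Category.comp_id]
        refine CubeCategory.pair_ext (n := s ≫ i) ?_ ?_ ?_ ?_
        · rw [B.comp_cod, face_cod]
        · rw [← h, hz]
        · have q₁ := CubeCategory.comp_pair_fst (B := B) (f := (s ≫ i) ≫ B.id)
            (g := B.comp (bang B (s ≫ i)) _ hbr)
            (by rw [B.comp_dom, bang_dom, Category.assoc _ B.id, B.id_dom, Category.comp_id])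
            (by rw [B.comp_cod, hr₁])
          refine (B.assoc _ _ _ hc ?_).trans (Eq.trans (cube_comp_congr rfl ?_ _ hx) i₁)
          · rw [face_cod, Category.assoc _ B.fst, B.fst_dom]
          · refine (cube_comp_congr rfl ?_ _ ?_).trans q₁
            · rw [← Category.assoc _ B.cod, Category.assoc _ B.id, B.id_cod, Category.comp_id]
            · rw [face, CubeCategory.pair_cod]; simp only [Category.assoc, B.fst_dom]
        · have q₁ := CubeCategory.comp_pair_snd (B := B) (f := (s ≫ i) ≫ B.id)
            (g := B.comp (bang B (s ≫ i)) _ hbr)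
            (by rw [B.comp_dom, bang_dom, Category.assoc _ B.id, B.id_dom, Category.comp_id])
            (by rw [B.comp_cod, hr₁])
          refine (B.assoc _ _ _ hc ?_).trans (Eq.trans (cube_comp_congr rfl ?_ _ ?_) i₂)
          · rw [face_cod, Category.assoc _ B.snd, B.snd_dom]
          · refine (cube_comp_congr rfl ?_ _ ?_).trans q₁
            · rw [← Category.assoc _ B.cod, Category.assoc _ B.id, B.id_cod, Category.comp_id]
            · rw [face, CubeCategory.pair_cod]; simp only [Category.assoc, B.snd_dom]
          · rw [B.comp_dom, hb]
      -- It suffices to treat the `n`-dimensional face of `z`. Restricting that face along the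
      -- projected point is restricting `z` along `p`, so the induction hypothesis applies.
      refine hF.fac_of_face (s ≫ i) _ hr₀ hr₁ u hu z hz ?_
      have hzf : z ≫ Z.dim = face (s ≫ i) _ hr₀ hr₁ ≫ B.cod := by rw [hz, face_cod]
      refine IH s _ _ hp₀ ?_ ?_ ?_
      · rw [Z.res_dim, face_dom, hp₁]
      · rw [Z.res_dim, face_dom]
      · rw [← Z.res_comp z _ _ hzf hc]
        rwa [Z.res_congr rfl hpf _ h]
  obtain ⟨e, he⟩ := hid
  exact (hS (𝟙 N.N)).1 ⟨e, he⟩ (z ≫ Z.dim) z p hp h (Category.comp_id _) H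

/-- A fibration is inhabited over a cube if it is inhabited over any reindexing of the cube. -/
theorem IsKanFibrationClass.fac_of_res (hE : LocallyCartesianClosed E) {U Z : CubicalSet B}
    (u : U ⟶ Z) (hu : Fib u) [Mono u.map] {T : E} (z : T ⟶ Z.carrier) (φ : T ⟶ B.Hom)
    (h : z ≫ Z.dim = φ ≫ B.cod) (H : Fac (Z.res z φ h) u.map) : Fac z u.map := by
  obtain ⟨p, hp₀, hp₁⟩ := B.exists_point
  -- Membership in `U` is preserved by restriction, so the reindexed cube may be restricted further,
  -- to a point.
  have hc : ((φ ≫ B.dom) ≫ p) ≫ B.cod = φ ≫ B.dom := by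
    rw [Category.assoc, hp₁, Category.comp_id]
  refine hF.fac_of_point hE u hu z (B.comp ((φ ≫ B.dom) ≫ p) φ hc) ?_ (by rw [B.comp_cod, h]) ?_
  · rw [B.comp_dom, Category.assoc, hp₀, precomp_terminal]
  · rw [Z.res_comp z _ φ h hc]
    obtain ⟨e, he⟩ := H
    have hd : e ≫ U.dim = ((φ ≫ B.dom) ≫ p) ≫ B.cod := by
      rw [← u.map_dim, ← Category.assoc, he, Z.res_dim, hc]
    exact ⟨U.res e _ hd, by rw [u.map_res]; exact Z.res_congr he rfl _ _⟩

end Invariance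

end CubicalSet

theorem IsInit.fac {C : Type u} [Category.{v} C] {W X Y : C} (h : IsInit W) (w : W ⟶ Y)
    (d : X ⟶ Y) : Fac w d := by
  obtain ⟨h⟩ := h
  exact ⟨h.to X, h.hom_ext _ _⟩

theorem fac_of_isColimit {C : Type u} [Category.{v} C] {X X' V Z : C} {c : BinaryCofan X X'}
    (hc : IsColimit c) (s : c.pt ⟶ Z) (p : V ⟶ Z) (h₁ : Fac (c.inl ≫ s) p)
    (h₂ : Fac (c.inr ≫ s) p) : Fac s p := by
  obtain ⟨e₁, he₁⟩ := h₁
  obtain ⟨e₂, he₂⟩ := h₂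
  obtain ⟨e, h₁, h₂⟩ := BinaryCofan.IsColimit.desc' hc e₁ e₂
  exact ⟨e, BinaryCofan.IsColimit.hom_ext hc (by rw [← Category.assoc, h₁, he₁])
    (by rw [← Category.assoc, h₂, he₂])⟩

namespace CubicalSet

variable {E : Type u} [Category.{v} E] [HasFiniteLimits E] {N : NNO E} {B : CubeCategory N}

/-- Maps to a constant cubical set. -/
def toConst {X : CubicalSet B} {S : E} (a : X.carrier ⟶ S)
    (ha : ∀ ⦃T : E⦄ (x : T ⟶ X.carrier) (φ : T ⟶ B.Hom) (h : x ≫ X.dim = φ ≫ B.cod),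
      X.res x φ h ≫ a = x ≫ a) : X ⟶ (const B).obj S where
  map := prod.lift a X.dim
  map_dim := prod.lift_snd _ _
  map_res {T} x φ h := by
    change _ = prod.lift _ _
    apply Limits.prod.hom_ext
    · simp [ha]
    · simp [X.res_dim]

/-! ### Closure properties of h-propositions. -/

section HProp

theorem comp_atPoint {A A' : CubicalSet B} (l : A' ⟶ A) (e : ⊤_ E ⟶ B.Hom)
    (h₀ : e ≫ B.dom = N.zero) (h₁ : e ≫ B.cod = N.zero ≫ N.succ) :
    l ≫ atPoint A e h₀ h₁ = atPoint A' e h₀ h₁ := by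
  apply hom_ext
  apply pullback.hom_ext
  · refine (Category.assoc _ _ _).trans ((congrArg (l.map ≫ ·) (pullback.lift_fst _ _ _)).trans
      (Eq.trans ?_ (pullback.lift_fst _ _ _).symm))
    rw [B.comp_natural]
    exact cube_comp_congr (by rw [precomp_bang, l.map_dim]) (precomp_terminal _ _) _ _
  · exact Subsingleton.elim _ _

theorem incl₀_map {A A' : CubicalSet B} (l : A' ⟶ A) :
    incl₀ A' ≫ prod.map (𝟙 _) l = l ≫ incl₀ A := by
  rw [incl₀, incl₀, prod.lift_map, prod.comp_lift, comp_atPoint]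
  simp

theorem incl₁_map {A A' : CubicalSet B} (l : A' ⟶ A) :
    incl₁ A' ≫ prod.map (𝟙 _) l = l ≫ incl₁ A := by
  rw [incl₁, incl₁, prod.lift_map, prod.comp_lift, comp_atPoint]
  simp

/-- The homotopy between the two projections is universal; any other is a reindexing of it. -/
theorem isHProp_iff {X Y : CubicalSet B} (f : X ⟶ Y) :
    IsHProp f ↔ ∀ ⦃A : CubicalSet B⦄ (a b : A ⟶ X), a ≫ f = b ≫ f → HomotopicOver f a b := by
  refine ⟨?_, fun h => h _ _ pullback.condition⟩
  rintro ⟨H, h₀, h₁, hH⟩ A a b hab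
  refine ⟨prod.map (𝟙 _) (pullback.lift a b hab) ≫ H, ?_, ?_, ?_⟩
  · rw [← Category.assoc, incl₀_map, Category.assoc, h₀, pullback.lift_fst]
  · rw [← Category.assoc, incl₁_map, Category.assoc, h₁, pullback.lift_snd]
  · rw [Category.assoc, hH, prod.map_snd_assoc, pullback.lift_fst_assoc]

theorem isHProp_of_mono {X Y : CubicalSet B} (f : X ⟶ Y) [Mono f] : IsHProp f := by
  rw [isHProp_iff]
  intro A a b hab
  obtain rfl := (cancel_mono f).1 hab
  exact ⟨prod.snd ≫ a, by simp [incl₀], by simp [incl₁], Category.assoc _ _ _⟩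

theorem IsHProp.pullback_snd {X Y Z : CubicalSet B} {f : X ⟶ Y} (hf : IsHProp f) (z : Z ⟶ Y) :
    IsHProp (pullback.snd f z) := by
  rw [isHProp_iff] at hf ⊢
  intro A a b hab
  obtain ⟨H, h₀, h₁, hH⟩ := hf (a ≫ pullback.fst f z) (b ≫ pullback.fst f z) (by
    rw [Category.assoc, Category.assoc, pullback.condition, ← Category.assoc, hab, Category.assoc])
  refine ⟨pullback.lift H (prod.snd ≫ a ≫ pullback.snd f z) ?_, ?_, ?_, ?_⟩
  · rw [hH]; simp only [Category.assoc, pullback.condition]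
  · apply pullback.hom_ext
    · rw [Category.assoc, pullback.lift_fst, h₀]
    · simp [incl₀]
  · apply pullback.hom_ext
    · rw [Category.assoc, pullback.lift_fst, h₁]
    · simp [incl₁, hab]
  · rw [pullback.lift_snd]

/-- Conjunctions of h-propositions are h-propositions. -/
theorem IsHProp.inter {X X' Y : CubicalSet B} {f : X ⟶ Y} {f' : X' ⟶ Y} (hf : IsHProp f)
    (hf' : IsHProp f') : IsHProp (pullback.snd f f' ≫ f') := by
  rw [isHProp_iff] at hf hf' ⊢
  intro A a b hab
  obtain ⟨H, h₀, h₁, hH⟩ := hf (a ≫ pullback.fst f f') (b ≫ pullback.fst f f') (by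
    simpa only [Category.assoc, pullback.condition] using hab)
  obtain ⟨H', h₀', h₁', hH'⟩ := hf' (a ≫ pullback.snd f f') (b ≫ pullback.snd f f') (by
    simpa only [Category.assoc, pullback.condition] using hab)
  refine ⟨pullback.lift H H' ?_, ?_, ?_, ?_⟩
  · rw [hH, hH']; simp only [Category.assoc, pullback.condition]
  · apply pullback.hom_ext <;> simp [h₀, h₀']
  · apply pullback.hom_ext <;> simp [h₁, h₁']
  · rw [pullback.lift_snd_assoc, hH', Category.assoc]

/-- Products of families of h-propositions are h-propositions. -/
theorem IsHProp.depProd {X Y Z P : CubicalSet B} {f : X ⟶ Y} {g : Y ⟶ Z} {p : P ⟶ Z}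
    (hf : IsHProp f) (h : IsDepProd f g p) : IsHProp p := by
  rw [isHProp_iff] at hf ⊢
  obtain ⟨ev, hev, h₁, h₂⟩ := h.exists_ev
  intro A a b hab
  let a' : pullback (a ≫ p) g ⟶ X := pullback.lift (pullback.fst _ _ ≫ a) (pullback.snd _ _)
    (by rw [Category.assoc, pullback.condition]) ≫ ev
  let b' : pullback (a ≫ p) g ⟶ X := pullback.lift (pullback.fst _ _ ≫ b) (pullback.snd _ _)
    (by rw [Category.assoc, ← hab, pullback.condition]) ≫ ev
  have ha' : a' ≫ f = pullback.snd _ _ := by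
    rw [Category.assoc, hev, pullback.lift_snd]
  have hb' : b' ≫ f = pullback.snd _ _ := by
    rw [Category.assoc, hev, pullback.lift_snd]
  obtain ⟨H, e₀, e₁, hH⟩ := hf a' b' (by rw [ha', hb'])
  -- Function extensionality: `H` is a path between the values of `a` and `b`. Regrouping the
  -- pullback over the cylinder as the cylinder of the pullback lets `H` be transposed to a path `k`
  -- of functions.
  let m : pullback ((prod.snd : interval B ⨯ A ⟶ A) ≫ a ≫ p) g ⟶
      interval B ⨯ pullback (a ≫ p) g :=
    prod.lift (pullback.fst _ _ ≫ prod.fst)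
      (pullback.lift (pullback.fst _ _ ≫ prod.snd) (pullback.snd _ _)
        (by rw [Category.assoc, pullback.condition]))
  obtain ⟨k, hk, hkl⟩ := h₁ (prod.snd ≫ a ≫ p) (m ≫ H) (by
    rw [Category.assoc, hH, ha', prod.lift_snd_assoc, pullback.lift_snd])
  have hi₀ : ∀ A : CubicalSet B, incl₀ A ≫ prod.snd = 𝟙 A := fun A => by simp [incl₀]
  have hi₁ : ∀ A : CubicalSet B, incl₁ A ≫ prod.snd = 𝟙 A := fun A => by simp [incl₁]
  have key : ∀ {S : CubicalSet B} (t : S ⟶ interval B ⨯ A) (y : S ⟶ Y)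
      (hy : (t ≫ k) ≫ p = y ≫ g), pullback.lift (t ≫ k) y hy ≫ ev =
        prod.lift (t ≫ prod.fst) (pullback.lift (t ≫ prod.snd) y (by
          rw [← hy, Category.assoc, Category.assoc, hk])) ≫ H := by
    intro S t y hy
    have hy' : t ≫ prod.snd ≫ a ≫ p = y ≫ g := by rw [← hy, Category.assoc, hk]
    have := (Category.assoc _ _ _).trans ((congrArg (pullback.lift t y hy' ≫ ·) hkl).trans
      (Category.assoc _ _ _).symm)
    convert this using 2
    · apply pullback.hom_ext <;> simp
    · apply Limits.prod.hom_ext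
      · simp [m]
      · apply pullback.hom_ext <;> simp [m]
  refine ⟨k, ?_, ?_, hk⟩
  · apply h₂
    · rw [Category.assoc, hk, ← Category.assoc, hi₀, Category.id_comp]
    · intro S s y hy hy'
      have hw : s ≫ a ≫ p = y ≫ g := by rw [← hy', Category.assoc]
      have e := key (s ≫ incl₀ A) y (by rw [← hy]; simp only [Category.assoc])
      have e' := congrArg (pullback.lift s y hw ≫ ·) e₀
      dsimp only [a'] at e'
      rw [← Category.assoc, ← Category.assoc] at e'
      convert e.trans (Eq.trans ?_ e') using 2
      · simp only [Category.assoc]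
      · apply pullback.hom_ext <;> simp
      · congr 1
        simp only [incl₀]
        apply Limits.prod.hom_ext
        · simp [comp_atPoint]
        · apply pullback.hom_ext <;> simp
  · apply h₂
    · rw [Category.assoc, hk, ← Category.assoc, hi₁, Category.id_comp, hab]
    · intro S s y hy hy'
      have hw : s ≫ a ≫ p = y ≫ g := by rw [hab, ← hy', Category.assoc]
      have e := key (s ≫ incl₁ A) y (by rw [← hy]; simp only [Category.assoc])
      have e' := congrArg (pullback.lift s y hw ≫ ·) e₁
      dsimp only [b'] at e'
      rw [← Category.assoc, ← Category.assoc] at e'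
      convert e.trans (Eq.trans ?_ e') using 2
      · simp only [Category.assoc]
      · apply pullback.hom_ext <;> simp
      · congr 1
        simp only [incl₁]
        apply Limits.prod.hom_ext
        · simp [comp_atPoint]
        · apply pullback.hom_ext <;> simp

theorem equivOver_of_fac {X X' Y : CubicalSet B} {f : X ⟶ Y} {f' : X' ⟶ Y} (hf : IsHProp f)
    (hf' : IsHProp f') (h : Fac f f') (h' : Fac f' f) : EquivOver f f' := by
  obtain ⟨i, hi⟩ := h
  obtain ⟨j, hj⟩ := h'
  refine ⟨i, j, hi, hj, (isHProp_iff f).1 hf _ _ ?_, (isHProp_iff f').1 hf' _ _ ?_⟩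
  · rw [Category.assoc, hj, hi, Category.id_comp]
  · rw [Category.assoc, hi, hj, Category.id_comp]

end HProp

/-! ### Fibrations as types, at generalised elements. -/

section Types

variable {Fib : MorphismProperty (CubicalSet B)} {q : Rationals N}

/-- The universal property only mentions which propositions receive a map, so types that imply each
other have the same truncations. -/
theorem IsTruncation.congr {X X' Y T : CubicalSet B} {f : X ⟶ Y} {f' : X' ⟶ Y} {t : T ⟶ Y}
    (h : IsTruncation Fib f t) (h₁ : Fac f f') (h₂ : Fac f' f) : IsTruncation Fib f' t where
  fib := h.fib
  isHProp := h.isHProp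
  unit := h₂.trans h.unit
  elim _ p hp hp' hg := h.elim p hp hp' (h₁.trans hg)

/-- Elimination from a mere existence statement to an h-proposition. -/
theorem MerelyInhabited.fac {X Y P : CubicalSet B} {f : X ⟶ Y} (h : MerelyInhabited Fib f)
    {p : P ⟶ Y} (hp : Fib p) (hp' : IsHProp p) (hf : Fac f p) : Fac (𝟙 Y) p := by
  obtain ⟨T, t, ht, hs⟩ := h
  exact Fac.trans (d := t) hs (ht.elim p hp hp' hf)

theorem IsClosedCut.fac {Y D W : CubicalSet B} {d : D ⟶ Y ⨯ rat B q} (h : IsClosedCut d)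
    (w : W ⟶ Y ⨯ rat B q) (H : ∀ ⦃S : CubicalSet B⦄ (s : S ⟶ W) (l : S ⟶ ltCtx q Y),
      s ≫ w = l ≫ lower q Y → Fac (l ≫ upper q Y) d) : Fac w d := by
  obtain ⟨G, g, hg, hk⟩ := h
  refine Fac.trans (d := g) ?_ hk
  rw [hg.fac_iff]
  intro S s l hl
  rw [fac_snd_iff]
  exact H s l hl

/-- A term of the sum consists of two rationals over the same element of `Y`, one outside the family
and one inside. -/
theorem fac_bounded_iff {Y D M W : CubicalSet B} (d : D ⟶ Y ⨯ rat B q) (n : M ⟶ Y ⨯ rat B q)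
    (w : W ⟶ Y) : Fac w (pullback.fst (n ≫ prod.fst) (d ≫ prod.fst) ≫ n ≫ prod.fst) ↔
      ∃ x x' : W ⟶ Y ⨯ rat B q, x ≫ prod.fst = w ∧ x' ≫ prod.fst = w ∧ Fac x n ∧ Fac x' d := by
  constructor
  · rintro ⟨e, rfl⟩
    refine ⟨e ≫ pullback.fst _ _ ≫ n, e ≫ pullback.snd _ _ ≫ d, ?_, ?_, ?_, ?_⟩
    · simp only [Category.assoc]
    · simp only [Category.assoc, pullback.condition]
    · exact ((Fac.refl n).precomp _).precomp _
    · exact ((Fac.refl d).precomp _).precomp _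
  · rintro ⟨_, _, hx, hx', ⟨a, rfl⟩, ⟨b, rfl⟩⟩
    rw [Category.assoc] at hx hx'
    exact ⟨pullback.lift a b (by rw [hx, hx']), by rw [pullback.lift_fst_assoc, hx]⟩

variable (hF : IsKanFibrationClass Fib)
include hF

namespace IsKanFibrationClass

theorem snd {X Y Z : CubicalSet B} {f : X ⟶ Y} (hf : Fib f) (z : Z ⟶ Y) :
    Fib (pullback.snd f z) :=
  hF.baseChange.of_isPullback (IsPullback.of_hasPullback f z) hf

theorem fst {X Y Z : CubicalSet B} {f : X ⟶ Y} (hf : Fib f) (z : Z ⟶ Y) :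
    Fib (pullback.fst z f) :=
  hF.baseChange.of_isPullback (IsPullback.of_hasPullback z f).flip hf

theorem inter {X X' Y : CubicalSet B} {f : X ⟶ Y} {f' : X' ⟶ Y} (hf : Fib f) (hf' : Fib f') :
    Fib (pullback.snd f f' ≫ f') :=
  hF.comp _ _ (hF.snd hf f') hf'

/-- An isomorphism is a pullback of the identity of `Δ 1`. -/
theorem of_isIso {X Y : CubicalSet B} (f : X ⟶ Y) [IsIso f] : Fib f := by
  let y : Y ⟶ (CubicalSet.const B).obj (⊤_ E) := toConst (terminal.from _) (fun _ _ _ _ => Subsingleton.elim _ _)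
  have h := hF.const (B := B) (𝟙 ((CubicalSet.const B).obj (⊤_ E)))
  exact hF.baseChange.of_isPullback
    (IsPullback.of_vert_isIso ⟨by rw [Category.comp_id]⟩ : IsPullback (f ≫ y) f (𝟙 _) y) h

theorem terminal_const (S : E) : Fib (terminal.from ((CubicalSet.const B).obj S)) := by
  let y : ⊤_ (CubicalSet B) ⟶ (CubicalSet.const B).obj (⊤_ E) :=
    toConst (terminal.from _) (fun _ _ _ _ => Subsingleton.elim _ _)
  have hm : Mono (terminal.from ((CubicalSet.const B).obj (⊤_ E))) := by
    refine ⟨fun a b _ => hom_ext ?_⟩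
    apply Limits.prod.hom_ext
    · exact Subsingleton.elim _ _
    · exact a.map_dim.trans b.map_dim.symm
  have : IsIso (terminal.from ((CubicalSet.const B).obj (⊤_ E))) :=
    ⟨y, by rw [← cancel_mono (terminal.from _)]; exact Subsingleton.elim _ _,
      Subsingleton.elim _ _⟩
  rw [Subsingleton.elim (terminal.from ((CubicalSet.const B).obj S))
    ((CubicalSet.const B).map (terminal.from S) ≫ terminal.from _)]
  exact hF.comp _ _ (hF.const _) (hF.of_isIso _)

theorem prod_fst {Y Z : CubicalSet B} (hZ : Fib (terminal.from Z)) :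
    Fib (prod.fst : Y ⨯ Z ⟶ Y) := by
  refine hF.baseChange.of_isPullback (f := terminal.from Y) (f' := prod.snd) ?_ hZ
  exact (IsPullback.of_is_product' (prodIsProd Y Z) terminalIsTerminal).flip

theorem prod_map_id {Y Z Z' : CubicalSet B} {f : Z ⟶ Z'} (hf : Fib f) :
    Fib (prod.map (𝟙 Y) f) := by
  refine hF.baseChange.of_isPullback (f := prod.snd) (f' := prod.snd) ?_ hf
  refine ⟨⟨(prod.map_snd _ _).symm⟩, ⟨PullbackCone.IsLimit.mk _
    (fun s => prod.lift (s.snd ≫ prod.fst) s.fst) (fun s => prod.lift_snd _ _) (fun s => ?_)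
    fun s k h₁ h₂ => ?_⟩⟩
  · apply Limits.prod.hom_ext
    · simp
    · simp [s.condition]
  · apply Limits.prod.hom_ext
    · rw [prod.lift_fst, ← h₂, Category.assoc, prod.map_fst, Category.comp_id]
    · rw [prod.lift_snd, h₁]

/-- The empty family is a pullback of the constant map `Δ 0 ⟶ Δ 1`, hence a fibration, and so is its
dependent product along `f`. -/
theorem exists_negation [FinitaryExtensive E] {X Y : CubicalSet B} {f : X ⟶ Y} (hf : Fib f) :
    ∃ (M : CubicalSet B) (n : M ⟶ Y), IsNegation f n ∧ Fib n := by
  let i : (CubicalSet.const B).obj (⊥_ E) ⟶ (CubicalSet.const B).obj (⊤_ E) :=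
    (CubicalSet.const B).map (initial.to _)
  let x : X ⟶ (CubicalSet.const B).obj (⊤_ E) :=
    toConst (terminal.from _) (fun _ _ _ _ => Subsingleton.elim _ _)
  obtain ⟨hO⟩ : IsInit (pullback i x) :=
    IsInit.of_hom (pullback.fst i x) (isInit_of_carrier isInit_carrier_const)
  have hi : Fib (hO.to X) := by
    rw [hO.hom_ext (hO.to X) (pullback.snd i x)]
    exact hF.snd (hF.const _) _
  obtain ⟨M, n, hn, hn'⟩ := hF.depProd _ _ hi hf
  exact ⟨M, n, ⟨_, hO, hn⟩, hn'⟩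

end IsKanFibrationClass

end Types

end CubicalSet

namespace CubicalSet

variable {E : Type u} [Category.{v} E] [HasFiniteLimits E] {N : NNO E} {B : CubeCategory N}

/-! ### Elements of products with constant cubical sets. -/

section Elements

variable {T X P Q : E} {Y Z : CubicalSet B}

theorem prod_carrier_ext {x y : T ⟶ (Y ⨯ Z).carrier}
    (h₁ : x ≫ (prod.fst : Y ⨯ Z ⟶ Y).map = y ≫ (prod.fst : Y ⨯ Z ⟶ Y).map)
    (h₂ : x ≫ (prod.snd : Y ⨯ Z ⟶ Z).map = y ≫ (prod.snd : Y ⨯ Z ⟶ Z).map) : x = y := by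
  have hd : y ≫ (Y ⨯ Z).dim = x ≫ (Y ⨯ Z).dim := by
    rw [← (prod.fst : Y ⨯ Z ⟶ Y).map_dim, ← Category.assoc, ← h₁, Category.assoc]
  have : yon x rfl = yon y hd := by
    apply Limits.prod.hom_ext
    · apply repr_hom_ext
      rw [yon_comp, yon_comp, gen_yon, gen_yon, h₁]
    · apply repr_hom_ext
      rw [yon_comp, yon_comp, gen_yon, gen_yon, h₂]
  rw [← gen_yon x rfl, this, gen_yon]

/-- The second component of an element of `Y ⨯ Δ X`. -/
def constSnd (Y : CubicalSet B) (X : E) : (Y ⨯ (const B).obj X).carrier ⟶ X :=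
  (prod.snd : Y ⨯ (const B).obj X ⟶ _).map ≫ prod.fst

theorem prod_const_ext {x y : T ⟶ (Y ⨯ (const B).obj X).carrier}
    (h₁ : x ≫ (prod.fst : Y ⨯ (const B).obj X ⟶ Y).map =
      y ≫ (prod.fst : Y ⨯ (const B).obj X ⟶ Y).map)
    (h₂ : x ≫ constSnd Y X = y ≫ constSnd Y X) : x = y := by
  refine prod_carrier_ext h₁ (Limits.prod.hom_ext ?_ ?_)
  · simpa only [constSnd, Category.assoc] using h₂
  · have e₁ := (prod.fst : Y ⨯ (const B).obj X ⟶ Y).map_dim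
    have e₂ : (prod.snd : Y ⨯ (const B).obj X ⟶ _).map ≫ prod.snd =
      (Y ⨯ (const B).obj X).dim := (prod.snd : Y ⨯ (const B).obj X ⟶ _).map_dim
    rw [Category.assoc, Category.assoc, e₂, ← e₁, ← Category.assoc, h₁, Category.assoc]

/-- The element of `Y ⨯ Δ X` with given components. -/
def elt (y : T ⟶ Y.carrier) (a : T ⟶ X) : T ⟶ (Y ⨯ (const B).obj X).carrier :=
  gen B (y ≫ Y.dim) ≫ (prod.lift (yon y rfl)
    (yon (X := (const B).obj X) (prod.lift a (y ≫ Y.dim)) (prod.lift_snd _ _))).map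

theorem elt_fst (y : T ⟶ Y.carrier) (a : T ⟶ X) :
    elt y a ≫ (prod.fst : Y ⨯ (const B).obj X ⟶ Y).map = y := by
  rw [elt, Category.assoc, lift_map_fst, gen_yon]

theorem elt_snd (y : T ⟶ Y.carrier) (a : T ⟶ X) : elt y a ≫ constSnd Y X = a := by
  rw [elt, constSnd, Category.assoc]
  rw [← Category.assoc (Hom.map _), lift_map_snd, ← Category.assoc, gen_yon, prod.lift_fst]

theorem comp_elt {S : E} (s : S ⟶ T) (y : T ⟶ Y.carrier) (a : T ⟶ X) :
    s ≫ elt y a = elt (s ≫ y) (s ≫ a) := by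
  apply prod_const_ext
  · rw [Category.assoc, elt_fst, elt_fst]
  · rw [Category.assoc, elt_snd, elt_snd]

theorem eq_elt (x : T ⟶ (Y ⨯ (const B).obj X).carrier) :
    x = elt (x ≫ (prod.fst : Y ⨯ (const B).obj X ⟶ Y).map) (x ≫ constSnd Y X) := by
  apply prod_const_ext
  · rw [elt_fst]
  · rw [elt_snd]

theorem const_res_fst {S : E} (x : T ⟶ ((const B).obj S).carrier) (φ : T ⟶ B.Hom)
    (h : x ≫ ((const B).obj S).dim = φ ≫ B.cod) :
    ((const B).obj S).res x φ h ≫ prod.fst = x ≫ prod.fst :=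
  prod.lift_fst _ _

theorem elt_dim (y : T ⟶ Y.carrier) (a : T ⟶ X) :
    elt y a ≫ (Y ⨯ (const B).obj X).dim = y ≫ Y.dim := by
  rw [← (prod.fst : Y ⨯ (const B).obj X ⟶ Y).map_dim, ← Category.assoc, elt_fst]

theorem elt_res (y : T ⟶ Y.carrier) (φ : T ⟶ B.Hom) (h : y ≫ Y.dim = φ ≫ B.cod) (a : T ⟶ X) :
    elt (Y.res y φ h) a = (Y ⨯ (const B).obj X).res (elt y a) φ (by rw [elt_dim, h]) := by
  apply prod_const_ext
  · rw [elt_fst, Hom.map_res]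
    exact Y.res_congr (elt_fst _ _).symm rfl _ _
  · rw [elt_snd, constSnd, ← Category.assoc, Hom.map_res, const_res_fst, Category.assoc]
    exact (elt_snd _ _).symm

/-- The map of constant cubical sets given by a map to a product. -/
def constPair (B : CubeCategory N) (k : X ⟶ P ⨯ Q) :
    (const B).obj X ⟶ (const B).obj P ⨯ (const B).obj Q :=
  prod.lift ((const B).map (k ≫ prod.fst)) ((const B).map (k ≫ prod.snd))

/-- The underlying pair of an element of `Δ P ⨯ Δ Q`. -/
def under (B : CubeCategory N) (P Q : E) :
    ((const B).obj P ⨯ (const B).obj Q).carrier ⟶ P ⨯ Q :=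
  prod.lift ((prod.fst : (const B).obj P ⨯ (const B).obj Q ⟶ _).map ≫ prod.fst)
    (constSnd _ _)

theorem constPair_under (k : X ⟶ P ⨯ Q) :
    (constPair B k).map ≫ under B P Q = prod.fst ≫ k := by
  rw [under, prod.comp_lift, constSnd, ← Category.assoc, ← Category.assoc, constPair,
    lift_map_fst, lift_map_snd]
  apply Limits.prod.hom_ext <;> simp

theorem under_ext {x y : T ⟶ ((const B).obj P ⨯ (const B).obj Q).carrier}
    (h : x ≫ under B P Q = y ≫ under B P Q)
    (hd : x ≫ ((const B).obj P ⨯ (const B).obj Q).dim =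
      y ≫ ((const B).obj P ⨯ (const B).obj Q).dim) : x = y := by
  have h₁ := congrArg (· ≫ prod.fst) h
  have h₂ := congrArg (· ≫ prod.snd) h
  simp only [under, Category.assoc, prod.lift_fst, prod.lift_snd] at h₁ h₂
  refine prod_const_ext (Limits.prod.hom_ext ?_ ?_) h₂
  · simpa only [Category.assoc] using h₁
  · have e : (prod.fst : (const B).obj P ⨯ (const B).obj Q ⟶ _).map ≫ prod.snd =
      ((const B).obj P ⨯ (const B).obj Q).dim :=
        (prod.fst : (const B).obj P ⨯ (const B).obj Q ⟶ _).map_dim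
    rw [Category.assoc, Category.assoc, e, hd]

theorem map_id_under (χ : Y ⟶ (const B).obj P) :
    (prod.map χ (𝟙 ((const B).obj Q))).map ≫ under B P Q =
      prod.lift ((prod.fst : Y ⨯ (const B).obj Q ⟶ Y).map ≫ χ.map ≫ prod.fst)
        (constSnd Y Q) := by
  rw [under, prod.comp_lift, ← Category.assoc, ← comp_map, prod.map_fst, constSnd, constSnd,
    ← Category.assoc, ← comp_map, prod.map_snd, Category.comp_id, comp_map, Category.assoc]

theorem fac_constPair_map_iff (k : X ⟶ P ⨯ Q)
    (x : T ⟶ ((const B).obj P ⨯ (const B).obj Q).carrier) :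
    Fac x (constPair B k).map ↔ Fac (x ≫ under B P Q) k := by
  constructor
  · rintro ⟨e, rfl⟩
    exact ⟨e ≫ prod.fst, by rw [Category.assoc, Category.assoc, constPair_under]⟩
  · rintro ⟨e, he⟩
    refine ⟨prod.lift e (x ≫ ((const B).obj P ⨯ (const B).obj Q).dim), under_ext ?_ ?_⟩
    · rw [Category.assoc, constPair_under, prod.lift_fst_assoc, he]
    · rw [Category.assoc, (constPair B k).map_dim, prod.lift_snd]

instance mono_constPair_map (k : X ⟶ P ⨯ Q) [Mono k] : Mono (constPair B k).map := by
  refine ⟨fun {T} x y h => Limits.prod.hom_ext ?_ ?_⟩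
  · have := congrArg (· ≫ under B P Q) h
    simp only [Category.assoc, constPair_under] at this
    rw [← cancel_mono k, Category.assoc, Category.assoc, this]
  · have := congrArg (· ≫ ((const B).obj P ⨯ (const B).obj Q).dim) h
    simpa only [Category.assoc, (constPair B k).map_dim] using this

instance mono_constPair (k : X ⟶ P ⨯ Q) [Mono k] : Mono (constPair B k) :=
  mono_of_mono_map _

theorem fac_constPair_iff {W : CubicalSet B} (k : X ⟶ P ⨯ Q) [Mono k]
    (w : W ⟶ (const B).obj P ⨯ (const B).obj Q) :
    Fac w (constPair B k) ↔ Fac (w.map ≫ under B P Q) k := by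
  rw [fac_iff_map, fac_constPair_map_iff]

theorem comp_constPair {X' : E} (f : X' ⟶ X) (k : X ⟶ P ⨯ Q) :
    (const B).map f ≫ constPair B k = constPair B (f ≫ k) := by
  rw [constPair, constPair, prod.comp_lift, ← Functor.map_comp, ← Functor.map_comp,
    Category.assoc, Category.assoc]

instance isIso_constPair_id : IsIso (constPair B (𝟙 (P ⨯ Q))) := by
  obtain ⟨s, hs⟩ : Fac (𝟙 _) (constPair B (𝟙 (P ⨯ Q))) := by
    rw [fac_constPair_iff]
    exact ⟨_, Category.comp_id _⟩
  exact ⟨s, by rw [← cancel_mono (constPair B (𝟙 (P ⨯ Q))), Category.assoc, hs]; simp, hs⟩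

theorem fib_constPair {Fib : MorphismProperty (CubicalSet B)} (hF : IsKanFibrationClass Fib)
    (k : X ⟶ P ⨯ Q) : Fib (constPair B k) := by
  rw [← Category.comp_id k, ← comp_constPair]
  exact hF.comp _ _ (hF.const _) (hF.of_isIso _)

end Elements

/-! ### Comparison of negation in cubical sets with negation in `E`. -/

section NotNot

variable [FinitaryExtensive E] {Fib : MorphismProperty (CubicalSet B)}
  (hF : IsKanFibrationClass Fib) (hE : LocallyCartesianClosed E)
include hF hE

/-- The carrier of the negation of a proposition is stable under double negation. -/
theorem isNotNotStable_map {M U Z : CubicalSet B} {n : M ⟶ Z} {u : U ⟶ Z} (hn : Fib n) [Mono n]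
    (hu : IsNegation n u) : IsNotNotStable u.map := by
  rw [isNotNotStable_iff hE]
  intro W w H
  rw [← fac_yon_iff w rfl, hu.fac_iff]
  intro S s hs
  -- It is enough that the carrier of `S` is empty. By `H`, this follows once every stage over it at
  -- which `w` lies in `U` is empty.
  refine isInit_of_carrier (H (s.map ≫ pullback.snd _ _) fun S' s' hs' => ?_)
  have h₁ : Fac (s.map ≫ (yon w rfl).map) n.map := by
    obtain ⟨e, he⟩ := hs
    exact ⟨e.map, congrArg Hom.map he⟩
  -- A priori `n` holds only at a restriction of `w`; invariance of the monic fibration `n` moves it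
  -- to `w` itself.
  have h₂ : Fac ((s.map ≫ pullback.snd _ _) ≫ w) n.map := by
    have e : s.map ≫ (yon w rfl).map = Z.res ((s.map ≫ pullback.snd _ _) ≫ w)
        (s.map ≫ pullback.fst _ _) (by
          simp only [Category.assoc, pullback.condition]) := by
      change s.map ≫ Z.res _ _ _ = _
      rw [Z.res_natural]
      exact Z.res_congr (Category.assoc _ _ _).symm rfl _ _
    rw [e] at h₁
    exact hF.fac_of_res hE n hn _ _ _ h₁
  have h₃ := h₂.precomp s'
  rw [← fac_yon_iff _ rfl] at hs' h₃
  rw [hu.fac_iff] at hs'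
  have h₄ := hs' (𝟙 _) (by rwa [Category.id_comp])
  exact IsInit.of_hom (gen B _) (isInit_iff_carrier.1 h₄)

end NotNot

/-! ### Cocuts are equivalent to their double negation. -/

section Cocuts

variable [FinitaryExtensive E] {Fib : MorphismProperty (CubicalSet B)}
  (hF : IsKanFibrationClass Fib) {q : Rationals N}
include hF

/-- Cocuts are stable under double negation. -/
theorem IsCocut.exists_notNot {Y D : CubicalSet B} {d : D ⟶ Y ⨯ rat B q} (hd : IsCocut Fib d) :
    ∃ (M U : CubicalSet B) (n : M ⟶ Y ⨯ rat B q) (u : U ⟶ Y ⨯ rat B q),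
      Fib n ∧ Fib u ∧ Mono n ∧ Mono u ∧ IsNegation n u ∧ Fac u d ∧ Fac d u := by
  obtain ⟨M, n, hn, hnF⟩ := hF.exists_negation hd.fib
  obtain ⟨U, u, hu, huF⟩ := hF.exists_negation hnF
  refine ⟨M, U, n, u, hnF, huF, hn.mono, hu.mono, hu, ?_, ?_⟩
  · refine hd.closed.fac u fun S s l hsl => ?_
    obtain ⟨M', n', hn', c, σ, ⟨hc⟩, hl, hr, hin⟩ := hd.located
    let d' := pullback.snd d (upper q Y)
    let g := pullback.snd u (lower q Y)
    have hd'F : Fib d' := hF.snd hd.fib _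
    -- `P` is the type `¬¬D(a) → D(b)` over the context `a < b`. The truncated disjunction is
    -- eliminated over that whole context, so the assumption `¬¬D(a)` has to be part of the target.
    obtain ⟨P, p, hp, hpF⟩ := hF.depProd (pullback.snd d' g) g (hF.snd hd'F _) (hF.snd huF _)
    have hpP : IsHProp p := ((hd.isHProp.pullback_snd _).pullback_snd _).depProd hp
    have h₁ : Fac (𝟙 _) p := by
      have a₁ : Fac (pullback.snd n' (lower q Y)) p := by
        rw [hp.fac_iff]
        intro V s y hy
        refine IsInit.fac ?_ _ _
        have h₁ : Fac (y ≫ g) g := (Fac.refl g).precomp y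
        have h₂ : Fac (y ≫ g) (pullback.snd n' (lower q Y)) := by
          rw [← hy]; exact (Fac.refl _).precomp s
        rw [fac_snd_iff] at h₁ h₂
        rw [hu.fac_iff] at h₁
        have h₃ := h₁ (𝟙 _)
        rw [Category.id_comp] at h₃
        refine h₃ ?_
        rw [hn'.fac_iff] at h₂
        rwa [hn.fac_iff]
      have a₂ : Fac (pullback.snd d (upper q Y)) p := by
        rw [hp.fac_iff]
        intro V s y hy
        rw [fac_snd_iff, ← hy]
        exact (Fac.refl _).precomp s
      exact hin.fac hpF hpP (fac_of_isColimit hc σ p (by rw [hl]; exact a₁) (by rw [hr]; exact a₂))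
    rw [hp.fac_iff] at h₁
    have h₂ : Fac l g := by
      rw [fac_snd_iff, ← hsl]
      exact (Fac.refl u).precomp s
    obtain ⟨y, hy⟩ := h₂
    have h₃ := h₁ l y (by rw [Category.comp_id, hy])
    rwa [fac_snd_iff, hy, fac_snd_iff] at h₃
  · rw [hu.fac_iff]
    intro S s hs
    rw [hn.fac_iff] at hs
    have := hs (𝟙 _)
    rw [Category.id_comp] at this
    exact this ((Fac.refl d).precomp s)

end Cocuts

/-! ### Classification of cocuts by maps to a constant cubical set. -/

section Classify

variable [FinitaryExtensive E] {Fib : MorphismProperty (CubicalSet B)}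
  (hF : IsKanFibrationClass Fib) (hE : LocallyCartesianClosed E) {q : Rationals N}
  {Ω : E} {m : ⊤_ E ⟶ Ω} (hm : IsNotNotStableClassifier m) {P : E} {ev : P ⨯ q.Q ⟶ Ω}
  (hP : ∀ ⦃T : E⦄ (h : T ⨯ q.Q ⟶ Ω), ∃! k : T ⟶ P, prod.map k (𝟙 q.Q) ≫ ev = h)
include hE hm hP

/-- Maps to `Δ P` are determined by the propositions that they classify. -/
theorem classify_unique {Y : CubicalSet B} (χ χ' : Y ⟶ (const B).obj P)
    (h : ∀ ⦃W : CubicalSet B⦄ (w : W ⟶ Y ⨯ rat B q),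
      Fac (w ≫ prod.map χ (𝟙 _)) (constPair B (pullback.snd m ev)) ↔
        Fac (w ≫ prod.map χ' (𝟙 _)) (constPair B (pullback.snd m ev))) : χ = χ' := by
  have key : ∀ (χ : Y ⟶ (const B).obj P) {S : E} (s : S ⟶ Y.carrier ⨯ q.Q),
      Fac (s ≫ prod.map (χ.map ≫ prod.fst) (𝟙 _) ≫ ev) m ↔
        Fac (yon (elt (s ≫ prod.fst) (s ≫ prod.snd)) rfl ≫ prod.map χ (𝟙 (rat B q)))
          (constPair B (pullback.snd m ev)) := by
    intro χ S s
    rw [yon_comp, fac_yon_iff, fac_constPair_map_iff, Category.assoc, map_id_under,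
      prod.comp_lift, ← Category.assoc (elt _ _), elt_fst, elt_snd, fac_snd_iff, ← Category.assoc]
    have : s ≫ prod.map (χ.map ≫ prod.fst) (𝟙 q.Q) =
        prod.lift ((s ≫ prod.fst) ≫ χ.map ≫ prod.fst) (s ≫ prod.snd) := by
      apply Limits.prod.hom_ext <;> simp
    rw [this]
  -- Only the component in `P` carries information, the other one being the dimension. It is
  -- determined by its transpose to `Ω`, hence by membership.
  have hc : χ.map ≫ prod.fst = χ'.map ≫ prod.fst := by
    refine (hP (prod.map (χ'.map ≫ prod.fst) (𝟙 _) ≫ ev)).unique ?_ rfl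
    refine hm.hom_ext hE _ _ fun S s => ?_
    rw [key, key]
    exact h _
  apply hom_ext
  apply Limits.prod.hom_ext
  · exact hc
  · exact χ.map_dim.trans χ'.map_dim.symm

include hF

/-- Cocuts are classified by maps to `Δ P`. -/
theorem IsCocut.exists_classify {Y D : CubicalSet B} {d : D ⟶ Y ⨯ rat B q}
    (hd : IsCocut Fib d) : ∃ χ : Y ⟶ (const B).obj P, ∀ ⦃W : CubicalSet B⦄ (w : W ⟶ Y ⨯ rat B q),
      Fac w d ↔ Fac (w ≫ prod.map χ (𝟙 _)) (constPair B (pullback.snd m ev)) := by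
  obtain ⟨M, U, n, u, hnF, huF, _, _, hu, hud, hdu⟩ := hd.exists_notNot hF
  -- The double negation `u` is classified in place of `d`, which need not be monic.
  obtain ⟨h, hh, -⟩ := hm.classify u.map inferInstance (isNotNotStable_map hF hE hnF hu)
  have hfac : ∀ {T : E} (x : T ⟶ (Y ⨯ rat B q).carrier), Fac x u.map ↔ Fac (x ≫ h) m := by
    intro T x
    constructor
    · rintro ⟨e, rfl⟩
      exact ⟨e ≫ terminal.from _, by rw [Category.assoc, Category.assoc, hh.w]⟩
    · rintro ⟨e, he⟩
      exact ⟨hh.lift e x he, hh.lift_snd _ _ _⟩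
  obtain ⟨c, hc, -⟩ := hP (elt (prod.fst : Y.carrier ⨯ q.Q ⟶ _) prod.snd ≫ h)
  have hc' : ∀ {T : E} (y : T ⟶ Y.carrier) (a : T ⟶ q.Q),
      prod.lift (y ≫ c) a ≫ ev = elt y a ≫ h := by
    intro T y a
    have : prod.lift (y ≫ c) a = prod.lift y a ≫ prod.map c (𝟙 _) := by simp
    rw [this, Category.assoc, hc, ← Category.assoc, comp_elt, prod.lift_fst, prod.lift_snd]
  -- Invariance is an equivalence of memberships in `U`: one direction is restriction of elements of
  -- `U`, the other is `fac_of_res`.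
  have hinv : ∀ ⦃T : E⦄ (x : T ⟶ Y.carrier) (φ : T ⟶ B.Hom) (e : x ≫ Y.dim = φ ≫ B.cod),
      Y.res x φ e ≫ c = x ≫ c := by
    intro T x φ e
    refine (hP (prod.map (x ≫ c) (𝟙 _) ≫ ev)).unique ?_ rfl
    refine hm.hom_ext hE _ _ fun S s => ?_
    have hs : ∀ y : T ⟶ Y.carrier, s ≫ prod.map (y ≫ c) (𝟙 _) ≫ ev =
        elt (s ≫ prod.fst ≫ y) (s ≫ prod.snd) ≫ h := by
      intro y
      rw [← hc', ← Category.assoc]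
      congr 1
      apply Limits.prod.hom_ext <;> simp
    rw [hs, hs, ← hfac, ← hfac, ← Category.assoc s, Y.res_natural]
    have e' : ((s ≫ prod.fst) ≫ x) ≫ Y.dim = ((s ≫ prod.fst) ≫ φ) ≫ B.cod := by
      simp only [Category.assoc, e]
    rw [elt_res _ _ e', ← Category.assoc s]
    constructor
    · exact hF.fac_of_res hE u huF _ _ _
    · rintro ⟨a, ha⟩
      have hd : a ≫ U.dim = ((s ≫ prod.fst) ≫ φ) ≫ B.cod := by
        rw [← u.map_dim, ← Category.assoc, ha, elt_dim, e']
      exact ⟨U.res a _ hd, by rw [u.map_res]; exact res_congr _ ha rfl _ _⟩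
  refine ⟨toConst c hinv, fun W w => ?_⟩
  have h₁ : Fac w d ↔ Fac w u := ⟨fun h => h.trans hdu, fun h => h.trans hud⟩
  rw [h₁, fac_iff_map, hfac, fac_constPair_iff, comp_map, Category.assoc, map_id_under,
    prod.comp_lift, fac_snd_iff]
  have : (toConst c hinv).map ≫ prod.fst = c := prod.lift_fst _ _
  rw [this, ← Category.assoc, hc', ← eq_elt]

end Classify

end CubicalSet

theorem fac_inter_iff {C : Type u} [Category.{v} C] [HasPullbacks C] {W X X' Y : C} (w : W ⟶ Y)
    (f : X ⟶ Y) (f' : X' ⟶ Y) : Fac w (pullback.snd f f' ≫ f') ↔ Fac w f ∧ Fac w f' := by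
  rw [fac_comp_iff]
  constructor
  · rintro ⟨y, rfl, h⟩
    exact ⟨(fac_snd_iff _ _ _).1 h, y, rfl⟩
  · rintro ⟨h, y, rfl⟩
    exact ⟨y, rfl, (fac_snd_iff _ _ _).2 h⟩

namespace CubicalSet

variable {E : Type u} [Category.{v} E] [HasFiniteLimits E] {N : NNO E} {B : CubeCategory N}

/-! ### Compatibility of the cocut conditions with reindexing. -/

section Reindexing

theorem eq_lift_map {C : Type u} [Category.{v} C] [HasBinaryProducts C] {W Y Y' Z : C}
    {w : W ⟶ Y} {x : W ⟶ Y' ⨯ Z} {χ : Y ⟶ Y'} (h : x ≫ prod.fst = w ≫ χ) :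
    prod.lift w (x ≫ prod.snd) ≫ prod.map χ (𝟙 Z) = x := by
  apply Limits.prod.hom_ext <;> simp [h]

variable [FinitaryExtensive E] {Fib : MorphismProperty (CubicalSet B)} {q : Rationals N}
  {Y D Y' K : CubicalSet B} {d : D ⟶ Y ⨯ rat B q} {k : K ⟶ Y' ⨯ rat B q} {χ : Y ⟶ Y'}
  (hd : ∀ ⦃W : CubicalSet B⦄ (w : W ⟶ Y ⨯ rat B q),
    Fac w d ↔ Fac (w ≫ prod.map χ (𝟙 _)) k)
include hd

theorem fac_negation_iff {M M' W : CubicalSet B} {n : M ⟶ Y ⨯ rat B q} {n' : M' ⟶ Y' ⨯ rat B q}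
    (hn : IsNegation d n) (hn' : IsNegation k n') (w : W ⟶ Y ⨯ rat B q) :
    Fac w n ↔ Fac (w ≫ prod.map χ (𝟙 _)) n' := by
  rw [hn.fac_iff, hn'.fac_iff]
  simp only [hd, Category.assoc]

/-- Reindexing along `χ` leaves the rational coordinate alone, so witnesses over `w ≫ χ` lift back
by pairing their rational parts with `w`. -/
theorem fac_bounded_reindex_iff {M M' W : CubicalSet B} {n : M ⟶ Y ⨯ rat B q}
    {n' : M' ⟶ Y' ⨯ rat B q} (hn : IsNegation d n) (hn' : IsNegation k n') (w : W ⟶ Y) :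
    Fac w (pullback.fst (n ≫ prod.fst) (d ≫ prod.fst) ≫ n ≫ prod.fst) ↔
      Fac (w ≫ χ) (pullback.fst (n' ≫ prod.fst) (k ≫ prod.fst) ≫ n' ≫ prod.fst) := by
  rw [fac_bounded_iff, fac_bounded_iff]
  constructor
  · rintro ⟨x, x', hx, hx', h, h'⟩
    refine ⟨x ≫ prod.map χ (𝟙 _), x' ≫ prod.map χ (𝟙 _), ?_, ?_, ?_, ?_⟩
    · rw [Category.assoc, prod.map_fst, ← Category.assoc, hx]
    · rw [Category.assoc, prod.map_fst, ← Category.assoc, hx']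
    · exact (fac_negation_iff hd hn hn' x).1 h
    · exact (hd x').1 h'
  · rintro ⟨x, x', hx, hx', h, h'⟩
    refine ⟨prod.lift w (x ≫ prod.snd), prod.lift w (x' ≫ prod.snd), prod.lift_fst _ _,
      prod.lift_fst _ _, ?_, ?_⟩
    · rw [fac_negation_iff hd hn hn', eq_lift_map hx]
      exact h
    · rw [hd, eq_lift_map hx']
      exact h'

omit [FinitaryExtensive E] in
/-- The type of proofs of closedness, in terms of generalised elements. -/
theorem fac_closed_iff {G Cl : CubicalSet B} {g : G ⟶ Y' ⨯ rat B q} {cl : Cl ⟶ Y'}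
    (hg : IsDepProd (pullback.snd k (upper q Y')) (lower q Y') g)
    (hcl : IsDepProd (pullback.snd k g) (g ≫ prod.fst) cl) :
    Fac χ cl ↔ ∀ ⦃W : CubicalSet B⦄ (w : W ⟶ Y ⨯ rat B q),
      (∀ ⦃S : CubicalSet B⦄ (s : S ⟶ W) (l : S ⟶ ltCtx q Y),
        s ≫ w = l ≫ lower q Y → Fac (l ≫ upper q Y) d) → Fac w d := by
  rw [hcl.fac_iff]
  constructor
  · intro H W w Hw
    have h₁ : Fac (w ≫ prod.map χ (𝟙 _)) g := by
      rw [hg.fac_iff]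
      intro S s y hy
      rw [fac_snd_iff]
      have hf := congrArg (· ≫ prod.fst) hy
      have hs := congrArg (· ≫ prod.snd) hy
      simp only [Category.assoc, prod.map_fst, prod.map_snd, Category.comp_id] at hf hs
      have := Hw s (prod.lift (s ≫ w ≫ prod.fst) (y ≫ prod.snd)) (by
        apply Limits.prod.hom_ext <;> simp [hs])
      rw [hd] at this
      convert this using 1
      apply Limits.prod.hom_ext <;> simp [hf]
    obtain ⟨y, hy⟩ := h₁
    have := H (w ≫ prod.fst) y (by rw [← Category.assoc y, hy, Category.assoc, Category.assoc,
      prod.map_fst])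
    rwa [fac_snd_iff, hy, ← hd] at this
  · intro H S s y hy
    rw [fac_snd_iff]
    rw [← Category.assoc] at hy
    have e := eq_lift_map hy.symm
    rw [← e, ← hd]
    refine H _ fun S' s' l hl => ?_
    rw [hd]
    have h₁ := (hg.fac_iff (y ≫ g)).1 ((Fac.refl g).precomp y) s' (l ≫ prod.map χ (𝟙 _)) (by
      rw [← e, ← Category.assoc, hl, Category.assoc, Category.assoc, prod.map_map, prod.map_map]
      simp)
    rw [fac_snd_iff] at h₁
    convert h₁ using 1
    rw [Category.assoc, Category.assoc, prod.map_map, prod.map_map]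
    simp

end Reindexing

/-! ### Negations and coproducts under `Δ`. -/

section Located

variable {P L : E}

/-- The generic element over `χ` is `prod.map χ (𝟙 Z)` itself. This rewrites the dependent product
along a projection as a single factorisation. -/
theorem fac_prodMap_iff {C : Type u} [Category.{v} C] [HasBinaryProducts C] {Y Y' Z T : C}
    {χ : Y ⟶ Y'} {t : T ⟶ Y' ⨯ Z} :
    Fac (prod.map χ (𝟙 Z)) t ↔ ∀ ⦃S : C⦄ (s : S ⟶ Y) (y : S ⟶ Y' ⨯ Z),
      s ≫ χ = y ≫ prod.fst → Fac y t := by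
  constructor
  · intro h S s y hy
    rw [← eq_lift_map hy.symm]
    exact h.precomp _
  · intro h
    exact h prod.fst _ (prod.map_fst _ _).symm

theorem map_const_under {Q : E} (f : L ⟶ Q) :
    (prod.map (𝟙 ((const B).obj P)) ((const B).map f)).map ≫ under B P Q =
      under B P L ≫ prod.map (𝟙 P) f := by
  rw [under, under, prod.comp_lift, constSnd, constSnd, ← Category.assoc, ← Category.assoc,
    ← comp_map, ← comp_map, prod.map_fst, prod.map_snd, Category.comp_id, prod.lift_map,
    Category.comp_id, comp_map, Category.assoc, Category.assoc]
  congr 2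
  exact prod.map_fst _ _

/-- Propositions between constant cubical sets are reindexed in `E`. -/
theorem fac_constPair_snd_iff {X Q : E} {W : CubicalSet B} (k : X ⟶ P ⨯ Q) [Mono k] (f : L ⟶ Q)
    (w : W ⟶ (const B).obj P ⨯ (const B).obj L) :
    Fac w (constPair B (pullback.snd k (prod.map (𝟙 P) f))) ↔
      Fac (w ≫ prod.map (𝟙 _) ((const B).map f)) (constPair B k) := by
  rw [fac_constPair_iff, fac_constPair_iff, fac_snd_iff, comp_map, Category.assoc,
    Category.assoc, map_const_under]

/-- `Δ` preserves negation. -/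
theorem fac_constPair_negation_iff [FinitaryExtensive E] {X M Q : E} {k : X ⟶ P ⨯ Q} [Mono k]
    {n : M ⟶ P ⨯ Q} (hn : IsNegation k n) {W : CubicalSet B}
    (w : W ⟶ (const B).obj P ⨯ (const B).obj Q) :
    Fac w (constPair B n) ↔
      ∀ ⦃S : CubicalSet B⦄ (s : S ⟶ W), Fac (s ≫ w) (constPair B k) → IsInit S := by
  have := hn.mono
  rw [fac_constPair_iff, hn.fac_iff]
  constructor
  · intro H S s hs
    rw [fac_constPair_iff] at hs
    refine isInit_of_carrier (H s.map ?_)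
    rwa [← Category.assoc]
  · intro H S s hs
    rw [← Category.assoc, ← fac_constPair_map_iff,
      ← fac_yon_iff _ (show _ = s ≫ W.dim by rw [Category.assoc, w.map_dim]),
      ← yon_comp s rfl] at hs
    exact IsInit.of_hom (gen B _) (isInit_iff_carrier.1 (H _ hs))

/-- A summand of a constant coproduct pulls back to a summand. -/
theorem exists_isPullback_summand {X X' : E} {j : X ⟶ P ⨯ L} [Mono j] {i : X ⟶ X'} [Mono i]
    {s : X' ⟶ P ⨯ L} (hi : i ≫ s = j) {V Z : CubicalSet B}
    (r : V ⟶ (const B).obj P ⨯ (const B).obj L) (z : Z ⟶ V) [Mono z]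
    (hz : ∀ ⦃W : CubicalSet B⦄ (w : W ⟶ V), Fac w z ↔ Fac (w ≫ r) (constPair B j)) :
    ∃ (l : Z ⟶ pullback (constPair B s) r) (a : Z.carrier ⟶ X),
      l ≫ pullback.snd _ _ = z ∧
      IsPullback l.map a ((pullback.fst (constPair B s) r).map ≫ prod.fst) i := by
  obtain ⟨a, ha⟩ := (hz z).1 (Fac.refl z)
  let l : Z ⟶ pullback (constPair B s) r := pullback.lift (a ≫ (const B).map i) z (by
    rw [Category.assoc, comp_constPair, hi, ha])
  have hl : l ≫ pullback.snd _ _ = z := pullback.lift_snd _ _ _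
  have hmono : Mono l := by
    have : Mono (l ≫ pullback.snd (constPair B s) r) := by rw [hl]; infer_instance
    exact mono_of_mono l (pullback.snd (constPair B s) r)
  have hl' : l.map ≫ (pullback.fst (constPair B s) r).map ≫ prod.fst =
      (a.map ≫ prod.fst) ≫ i := by
    rw [← Category.assoc, ← comp_map, pullback.lift_fst, comp_map, Category.assoc, Category.assoc]
    congr 1
    exact prod.map_fst _ _
  refine ⟨l, a.map ≫ prod.fst, hl, (isPullback_of_mono_of_fac hl'.symm fun T y hy => ?_).flip⟩
  obtain ⟨e, he⟩ := hy
  have hpb := isPullback_map (IsPullback.of_hasPullback (constPair B s) r)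
  have hye : (y ≫ (pullback.snd (constPair B s) r).map) ≫ r.map ≫ under B P L = e ≫ j := by
    rw [← Category.assoc, Category.assoc y, ← hpb.w, Category.assoc, Category.assoc,
      constPair_under, ← hi, ← Category.assoc e, he]
    simp only [Category.assoc]
  -- An element of the pullback indexed by the summand `i` lies over an element where `j` holds,
  -- hence comes from `Z`. What remains is to compare components.
  have hyz : Fac (y ≫ (pullback.snd (constPair B s) r).map) z.map := by
    rw [← fac_yon_iff _ rfl, hz, yon_comp, fac_yon_iff, fac_constPair_map_iff, Category.assoc,
      hye]
    exact ⟨e, rfl⟩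
  obtain ⟨x, hx⟩ := hyz
  have hx' : (x ≫ l.map) ≫ (pullback.snd (constPair B s) r).map =
      y ≫ (pullback.snd (constPair B s) r).map := by
    rw [Category.assoc, ← comp_map, hl, hx]
  refine ⟨x, hpb.hom_ext (Limits.prod.hom_ext ?_ ?_) hx'⟩
  · rw [Category.assoc, Category.assoc, hl', Category.assoc y, ← he, ← Category.assoc]
    congr 1
    rw [← cancel_mono j, Category.assoc, Category.assoc, ← constPair_under (B := B),
      ← Category.assoc a.map, ← comp_map, ha, comp_map, Category.assoc, ← Category.assoc, hx,
      hye]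
  · have e₁ := (pullback.fst (constPair B s) r).map_dim
    have e₂ := (pullback.snd (constPair B s) r).map_dim
    rw [Category.assoc (x ≫ l.map), Category.assoc y]
    refine (congrArg ((x ≫ l.map) ≫ ·) (e₁.trans e₂.symm)).trans
      (Eq.trans ?_ (congrArg (y ≫ ·) (e₂.trans e₁.symm)))
    dsimp only
    rw [← Category.assoc, hx', Category.assoc]

end Located

end CubicalSet

namespace CubicalSet

variable {E : Type u} [Category.{v} E] [HasFiniteLimits E] {N : NNO E} {B : CubeCategory N}

/-! ### The universal cocut. -/

section Universal

variable {Fib : MorphismProperty (CubicalSet B)} (hF : IsKanFibrationClass Fib) {q : Rationals N}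
include hF

theorem isClosedCut_of_fac {Y D : CubicalSet B} {d : D ⟶ Y ⨯ rat B q} (hd : Fib d)
    (H : ∀ ⦃W : CubicalSet B⦄ (w : W ⟶ Y ⨯ rat B q),
      (∀ ⦃S : CubicalSet B⦄ (s : S ⟶ W) (l : S ⟶ ltCtx q Y),
        s ≫ w = l ≫ lower q Y → Fac (l ≫ upper q Y) d) → Fac w d) : IsClosedCut d := by
  obtain ⟨G, g, hg, -⟩ := hF.depProd (pullback.snd d (upper q Y)) (lower q Y) (hF.snd hd _)
    (hF.prod_map_id (hF.const _))
  refine ⟨G, g, hg, H g fun S s l hl => ?_⟩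
  rw [← fac_snd_iff]
  exact (hg.fac_iff g).1 (Fac.refl g) s l hl

variable [FinitaryExtensive E] {P K M : E} {k : K ⟶ P ⨯ q.Q} [Mono k] {n : M ⟶ P ⨯ q.Q}
  (hn : IsNegation k n)

/-- The summands of the universal locatedness statement, as a map in `E`. -/
def locatedMap (q : Rationals N) {P K M : E} (k : K ⟶ P ⨯ q.Q) (n : M ⟶ P ⨯ q.Q) :
    pullback n (prod.map (𝟙 P) q.ltFst) ⨿ pullback k (prod.map (𝟙 P) q.ltSnd) ⟶ P ⨯ q.Lt :=
  coprod.desc (pullback.snd _ _) (pullback.snd _ _)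

include hn

omit hF in
theorem fac_summand_iff {Y D M' : CubicalSet B} {d : D ⟶ Y ⨯ rat B q} {n' : M' ⟶ Y ⨯ rat B q}
    (hn' : IsNegation d n') {χ : Y ⟶ (const B).obj P}
    (hd : ∀ ⦃W : CubicalSet B⦄ (w : W ⟶ Y ⨯ rat B q),
      Fac w d ↔ Fac (w ≫ prod.map χ (𝟙 _)) (constPair B k)) {W : CubicalSet B}
    (w : W ⟶ ltCtx q Y) :
    Fac w (pullback.snd n' (lower q Y)) ↔
      Fac (w ≫ prod.map χ (𝟙 _)) (constPair B (pullback.snd n (prod.map (𝟙 P) q.ltFst))) := by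
  have := hn.mono
  rw [fac_snd_iff, fac_constPair_snd_iff, fac_constPair_negation_iff hn, hn'.fac_iff]
  simp only [hd, Category.assoc, prod.map_map, Category.id_comp, Category.comp_id]

omit hF hn [FinitaryExtensive E] in
theorem fac_summand_iff' {Y D : CubicalSet B} {d : D ⟶ Y ⨯ rat B q} {χ : Y ⟶ (const B).obj P}
    (hd : ∀ ⦃W : CubicalSet B⦄ (w : W ⟶ Y ⨯ rat B q),
      Fac w d ↔ Fac (w ≫ prod.map χ (𝟙 _)) (constPair B k)) {W : CubicalSet B}
    (w : W ⟶ ltCtx q Y) :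
    Fac w (pullback.snd d (upper q Y)) ↔
      Fac (w ≫ prod.map χ (𝟙 _)) (constPair B (pullback.snd k (prod.map (𝟙 P) q.ltSnd))) := by
  rw [fac_snd_iff, fac_constPair_snd_iff, hd]
  simp only [Category.assoc, prod.map_map, Category.id_comp, Category.comp_id]

/-- The two summands over `Y` map to `Δ` of the corresponding summands in `E`, hence to the
truncation `t`. Its pullback is a fibrant h-proposition, so the truncated disjunction eliminates
into it. -/
theorem IsLocated.fac {Y D T : CubicalSet B} {d : D ⟶ Y ⨯ rat B q} (h : IsLocated Fib d)
    {χ : Y ⟶ (const B).obj P}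
    (hd : ∀ ⦃W : CubicalSet B⦄ (w : W ⟶ Y ⨯ rat B q),
      Fac w d ↔ Fac (w ≫ prod.map χ (𝟙 _)) (constPair B k))
    {t : T ⟶ ltCtx q ((const B).obj P)}
    (ht : IsTruncation Fib (constPair B (locatedMap q k n)) t) :
    Fac (prod.map χ (𝟙 ((const B).obj q.Lt))) t := by
  obtain ⟨M', n', hn', c, σ, ⟨hc⟩, hl, hr, hin⟩ := h
  have hunit : Fac (constPair B (locatedMap q k n)) t := ht.unit
  have a₁ : Fac (pullback.snd n' (lower q Y)) (pullback.snd t (prod.map χ (𝟙 _))) := by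
    rw [fac_snd_iff]
    refine ((fac_summand_iff hn hn' hd _).1 (Fac.refl _)).trans (Fac.trans ?_ hunit)
    exact ⟨(const B).map coprod.inl, by rw [comp_constPair, locatedMap, coprod.inl_desc]⟩
  have a₂ : Fac (pullback.snd d (upper q Y)) (pullback.snd t (prod.map χ (𝟙 _))) := by
    rw [fac_snd_iff]
    refine ((fac_summand_iff' hd _).1 (Fac.refl _)).trans (Fac.trans ?_ hunit)
    exact ⟨(const B).map coprod.inr, by rw [comp_constPair, locatedMap, coprod.inr_desc]⟩
  have := hin.fac (hF.snd ht.fib _) (ht.isHProp.pullback_snd _)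
    (fac_of_isColimit hc σ (pullback.snd t (prod.map χ (𝟙 _))) (by rw [hl]; exact a₁)
      (by rw [hr]; exact a₂))
  rwa [fac_snd_iff, Category.id_comp] at this

/-- Conversely, both summands are pullbacks of the coproduct injections in `E`. Extensivity makes
the pullback of the universal sum a coproduct of `¬d` and `d`, and truncation is stable under this
pullback. -/
theorem isLocated_of_fac {Y D T : CubicalSet B} {d : D ⟶ Y ⨯ rat B q} [Mono d] (hdF : Fib d)
    {χ : Y ⟶ (const B).obj P}
    (hd : ∀ ⦃W : CubicalSet B⦄ (w : W ⟶ Y ⨯ rat B q),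
      Fac w d ↔ Fac (w ≫ prod.map χ (𝟙 _)) (constPair B k))
    {t : T ⟶ ltCtx q ((const B).obj P)}
    (ht : ∀ ⦃Z : CubicalSet B⦄ (z : Z ⟶ ltCtx q ((const B).obj P)),
      IsTruncation Fib (pullback.snd (constPair B (locatedMap q k n)) z) (pullback.snd t z))
    (h : Fac (prod.map χ (𝟙 ((const B).obj q.Lt))) t) : IsLocated Fib d := by
  obtain ⟨M', n', hn', -⟩ := hF.exists_negation hdF
  have := hn.mono
  have := hn'.mono
  obtain ⟨l, a, hl, hla⟩ := exists_isPullback_summand (B := B)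
    (coprod.inl_desc _ _ : coprod.inl ≫ locatedMap q k n = _) (prod.map χ (𝟙 _))
    (pullback.snd n' (lower q Y)) (fun W w => fac_summand_iff hn hn' hd w)
  obtain ⟨r, b, hr, hrb⟩ := exists_isPullback_summand (B := B)
    (coprod.inr_desc _ _ : coprod.inr ≫ locatedMap q k n = _) (prod.map χ (𝟙 _))
    (pullback.snd d (upper q Y)) (fun W w => fac_summand_iff' hd w)
  refine ⟨M', n', hn', BinaryCofan.mk l r, pullback.snd _ _, ?_, hl, hr, _, _, ht _, ?_⟩
  · exact isColimit_of_carrier l r (isColimit_of_isPullback ⟨coprodIsCoprod _ _⟩ hla hrb)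
  · exact (fac_snd_iff (𝟙 _) t _).2 (by rwa [Category.id_comp])

end Universal

theorem exists_isTypeOfDedekindReals [FinitaryExtensive E] (hE : LocallyCartesianClosed E)
    (q : Rationals N) {Fib : MorphismProperty (CubicalSet B)} (hF : IsKanFibrationClass Fib)
    {Ω : E} {m : ⊤_ E ⟶ Ω} (hm : IsNotNotStableClassifier m) :
    ∃ (R K : CubicalSet B) (c : K ⟶ R ⨯ rat B q), IsTypeOfDedekindReals Fib c := by
  obtain ⟨P, ev, hP⟩ := hE.exists_power Ω q.Q
  let k := pullback.snd m ev
  let κ := constPair B k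
  have hκ : Fib κ := fib_constPair hF k
  have hfst : ∀ S : E, Fib (prod.fst : (const B).obj P ⨯ (const B).obj S ⟶ _) :=
    fun S => hF.prod_fst (hF.terminal_const S)
  -- boundedness
  obtain ⟨M', n', hn', hn'F⟩ := hF.exists_negation hκ
  obtain ⟨T₁, t₁, ht₁, ht₁'⟩ := hF.truncation
    (pullback.fst (n' ≫ prod.fst) (κ ≫ prod.fst) ≫ n' ≫ prod.fst)
    (hF.comp _ _ (hF.fst (hF.comp _ _ hκ (hfst _)) _) (hF.comp _ _ hn'F (hfst _)))
  -- closedness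
  obtain ⟨G, g, hg, hgF⟩ := hF.depProd (pullback.snd κ (upper q _)) (lower q _) (hF.snd hκ _)
    (hF.prod_map_id (hF.const _))
  obtain ⟨Cl, cl, hcl, hclF⟩ := hF.depProd (pullback.snd κ g) (g ≫ prod.fst) (hF.snd hκ _)
    (hF.comp _ _ hgF (hfst _))
  -- locatedness
  obtain ⟨M, n, hn⟩ := hE.exists_negation k
  obtain ⟨T₂, t₂, ht₂, ht₂'⟩ := hF.truncation (constPair B (locatedMap q k n))
    (fib_constPair hF _)
  -- Quantifies over all pairs `a < b`, leaving a proposition over `Δ P`.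
  obtain ⟨L, l, hl, hlF⟩ := hF.depProd t₂ prod.fst ht₂.fib (hfst _)
  have hlfac : ∀ {Y : CubicalSet B} (χ : Y ⟶ (const B).obj P),
      Fac χ l ↔ Fac (prod.map χ (𝟙 ((const B).obj q.Lt))) t₂ := by
    intro Y χ
    rw [hl.fac_iff, fac_prodMap_iff]
  let cll := pullback.snd cl l ≫ l
  let ρ := pullback.snd t₁ cll ≫ cll
  have hρF : Fib ρ := hF.inter ht₁.fib (hF.inter hclF hlF)
  -- Closedness is an h-proposition because `κ` is monic, the other two conditions because of the
  -- truncations.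
  have hρP : IsHProp ρ :=
    ht₁.isHProp.inter ((isHProp_of_mono (pullback.snd κ g)).depProd hcl |>.inter
      (ht₂.isHProp.depProd hl))
  have hρ : ∀ {Y : CubicalSet B} (χ : Y ⟶ (const B).obj P),
      Fac χ ρ ↔ Fac χ t₁ ∧ Fac χ cl ∧ Fac χ l := by
    intro Y χ
    rw [fac_inter_iff, fac_inter_iff]
  obtain ⟨hρ₁, hρ₂, hρ₃⟩ := (hρ ρ).1 (Fac.refl ρ)
  let c := pullback.snd κ (prod.map ρ (𝟙 (rat B q)))
  have hcF : Fib c := hF.snd hκ _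
  have hc : ∀ ⦃W : CubicalSet B⦄ (w : W ⟶ _ ⨯ rat B q),
      Fac w c ↔ Fac (w ≫ prod.map ρ (𝟙 _)) κ := fun W w => fac_snd_iff _ _ _
  have hcχ : ∀ {Y : CubicalSet B} (χ : Y ⟶ _) ⦃W : CubicalSet B⦄ (w : W ⟶ Y ⨯ rat B q),
      Fac w (pullback.snd c (prod.map χ (𝟙 _))) ↔ Fac (w ≫ prod.map (χ ≫ ρ) (𝟙 _)) κ := by
    intro Y χ W w
    rw [fac_snd_iff, hc, Category.assoc, prod.map_map, Category.id_comp]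
  refine ⟨_, _, c, ?_, ⟨hcF, isHProp_of_mono c, ?_, ?_, ?_⟩, ?_, ?_⟩
  · rw [Subsingleton.elim (terminal.from _) (ρ ≫ terminal.from _)]
    exact hF.comp _ _ hρF (hF.terminal_const P)
  · obtain ⟨M'', n'', hn'', -⟩ := hF.exists_negation hcF
    -- The sum formed over `R` and the sum pulled back from `Δ P` imply each other, so the pulled
    -- back truncation truncates both.
    refine ⟨M'', n'', hn'', _, pullback.snd t₁ ρ, (ht₁' ρ).congr ?_ ?_, ?_⟩
    · rw [fac_bounded_reindex_iff hc hn'' hn', ← fac_snd_iff]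
      exact Fac.refl _
    · rw [fac_snd_iff, ← fac_bounded_reindex_iff hc hn'' hn']
      exact Fac.refl _
    · exact (fac_snd_iff (𝟙 _) t₁ ρ).2 (by rwa [Category.id_comp])
  · exact isClosedCut_of_fac hF hcF ((fac_closed_iff hc hg hcl).1 hρ₂)
  · exact isLocated_of_fac hF hn hcF hc ht₂' ((hlfac ρ).1 hρ₃)
  · intro Y D d hd
    obtain ⟨χ, hχ⟩ := hd.exists_classify hF hE hm hP
    have hχρ : Fac χ ρ := by
      refine (hρ χ).2 ⟨?_, (fac_closed_iff hχ hg hcl).2 fun W w => hd.closed.fac w,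
        (hlfac χ).2 (hd.located.fac hF hn hχ ht₂)⟩
      obtain ⟨M'', n'', hn'', hin⟩ := hd.bounded
      have := hin.fac (hF.snd ht₁.fib χ) (ht₁.isHProp.pullback_snd χ) (by
        rw [fac_snd_iff]
        refine Fac.trans ?_ ht₁.unit
        exact (fac_bounded_reindex_iff hχ hn'' hn' _).1 (Fac.refl _))
      rwa [fac_snd_iff, Category.id_comp] at this
    obtain ⟨r, rfl⟩ := hχρ
    refine ⟨r, equivOver_of_fac hd.isHProp (isHProp_of_mono _) ?_ ?_⟩
    · rw [hcχ, ← hχ]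
      exact Fac.refl d
    · rw [hχ, ← hcχ]
      exact Fac.refl _
  · rintro Y χ χ' ⟨i, j, hi, hj, -, -⟩
    -- Mutual implication of the two families already forces equality in `Δ P`; the homotopies of
    -- the equivalence play no role.
    have e : χ ≫ ρ = χ' ≫ ρ := by
      refine classify_unique hE hm hP _ _ fun W w => ?_
      rw [← hcχ, ← hcχ]
      exact ⟨fun h => h.trans ⟨i, hi⟩, fun h => h.trans ⟨j, hj⟩⟩
    obtain ⟨H, h₀, h₁, -⟩ := (isHProp_iff ρ).1 hρP χ χ' e
    exact ⟨H, h₀, h₁⟩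

end CubicalSet

end

end CubicalReals

theorem mainTheorem3 {E : Type u} [Category.{v} E] [Regular E] [FinitaryExtensive E]
    (hE : CubicalReals.LocallyCartesianClosed E)
    (N : CubicalReals.NNO E) (q : CubicalReals.Rationals N)
    (B : CubicalReals.CubeCategory N)
    (Fib : MorphismProperty (CubicalReals.CubicalSet B))
    (hFib : CubicalReals.CubicalSet.IsKanFibrationClass Fib)
    {Ω : E} (m : ⊤_ E ⟶ Ω) (hm : CubicalReals.IsNotNotStableClassifier m) :
    ∃ (R K : CubicalReals.CubicalSet B) (c : K ⟶ R ⨯ CubicalReals.CubicalSet.rat B q),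
      CubicalReals.CubicalSet.IsTypeOfDedekindReals Fib c :=
  CubicalReals.CubicalSet.exists_isTypeOfDedekindReals hE q hFib hm
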